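/- For $r>0$ and a positive sequence $M=(M_n)_{n\ge0}$, let $\mathcal C_M([-r,r])$ be the Denjoy--Carleman class of all real-valued $\psi\in C^\infty([-r,r])$ for which there is a constant $K>0$ with $\sup_{|t|\le r}|\psi^{(n)}(t)|\le K^{n+1}M_n$ for all $n\ge0$. For a phase $\psi$ on $[-r,r]$ and $\lambda\in\mathbb R$ put $$m_{r,\psi}(\lambda)=\mathrm{p.v.}\int_{-r}^{r}e^{i\lambda\psi(t)}\,\frac{dt}{t}=\lim_{\varepsilon\to0^+}\int_{\varepsilon\le|t|\le r}e^{i\lambda\psi(t)}\,\frac{dt}{t}.$$ Let $\alpha>1$. (i) Let $c>0$ and $M_n=\exp(cn^\alpha)$. For every $\psi\in\mathcal C_M([-1,1])$ the principal value $m_{1,\psi}(\lambda)$ exists for all real $\lambda$, and $m_{1,\psi}(\lambda)=O\big((\log\lambda)^{1-1/\alpha}\big)$ as $\lambda\to\infty$ (the implied constant may depend on $\psi$). (ii) This is sharp: for every $c>0$ there is a real-valued $\psi\in\mathcal C_M([-1,1])$, $M_n=\exp(cn^\alpha)$, and a sequence $\lambda_n\to\infty$ such that $|m_{1,\psi}(\lambda_n)|\approx(\log\lambda_n)^{1-1/\alpha}$,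 that is, for all large $n$ the two sides are bounded by constant multiples of each other, with positive constants independent of $n$. (iii) Explicitly, the phase given by $\psi(t)=0$ for $t\le0$ and $\psi(t)=\exp\big(-(\log\frac1t)^{\alpha/(\alpha-1)}\big)$ for $0<t\le 1/e$ belongs to $\mathcal C_M([-1/e,1/e])$ with $M_n=\exp(cn^\alpha)$ for some $c>0$; the principal value $m_{1/e,\psi}(\lambda)$ exists for all real $\lambda$, and $|m_{1/e,\psi}(\lambda_n)|\approx(\log\lambda_n)^{1-1/\alpha}$ along a sequence $\lambda_n\to\infty$. -/

import Mathlib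

open Filter Topology Asymptotics
open scoped ContDiff

noncomputable section

namespace SteinWainger

/-- The integral of `e^{iλψ(t)} / t` over `ε ≤ |t| ≤ r` (used for `0 < ε < r`). -/
def truncated (r : ℝ) (ψ : ℝ → ℝ) (lam ε : ℝ) : ℂ :=
  (∫ t in (-r)..(-ε), Complex.exp (Complex.I * (lam * ψ t : ℝ)) / (t : ℂ)) +
    ∫ t in ε..r, Complex.exp (Complex.I * (lam * ψ t : ℝ)) / (t : ℂ)

/-- The principal value `p.v. ∫_{-r}^{r} e^{iλψ(t)} dt/t` exists and equals `z`. -/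
def HasPV (r : ℝ) (ψ : ℝ → ℝ) (lam : ℝ) (z : ℂ) : Prop :=
  Tendsto (truncated r ψ lam) (𝓝[>] 0) (𝓝 z)

/-- The oscillatory integral `m(λ) = p.v. ∫_{-r}^{r} e^{iλψ(t)} dt/t`. It is meaningful when the
principal value exists, which is always asserted separately through `HasPV`. -/
def m (r : ℝ) (ψ : ℝ → ℝ) (lam : ℝ) : ℂ :=
  limUnder (𝓝[>] (0 : ℝ)) (truncated r ψ lam)

/-- The Denjoy–Carleman class `C_M([-r, r])` of real-valued functions; derivatives at the end
points are one-sided. Only the values of `ψ` on `[-r, r]` matter. -/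
def MemDenjoyCarleman (M : ℕ → ℝ) (r : ℝ) (ψ : ℝ → ℝ) : Prop :=
  ContDiffOn ℝ ∞ ψ (Set.Icc (-r) r) ∧
    ∃ K : ℝ, 0 < K ∧ ∀ n : ℕ, ∀ t ∈ Set.Icc (-r) r,
      |iteratedDerivWithin n ψ (Set.Icc (-r) r) t| ≤ K ^ (n + 1) * M n

/-- The weight sequence `M_n = exp(c n^α)`. -/
def weight (c α : ℝ) (n : ℕ) : ℝ := Real.exp (c * (n : ℝ) ^ α)

/-- The phase equal to `0` for `t ≤ 0` and to `exp(-(log(1/t))^{α/(α-1)})` for `t > 0`;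
it is only considered for `t ≤ 1/e`. -/
def sharpPhase (α : ℝ) (t : ℝ) : ℝ :=
  if t ≤ 0 then 0 else Real.exp (-((Real.log (1 / t)) ^ (α / (α - 1))))

/-- `|m(λ_n)| ≈ (log λ_n)^{1-1/α}` along some sequence `λ_n → ∞`. -/
def AttainsGrowth (α r : ℝ) (ψ : ℝ → ℝ) : Prop :=
  ∃ lam : ℕ → ℝ, Tendsto lam atTop atTop ∧
    (fun n => ‖m r ψ (lam n)‖) =Θ[atTop] (fun n => (Real.log (lam n)) ^ (1 - 1 / α))

end SteinWainger

end

/-!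
For the upper bound, replace `ψ` on `|t| ≤ δ` by its Taylor polynomial of degree `n`. The bounds on
`ψ^{(n)}` make the error harmless when `log λ ≈ n^α` and `log (1/δ) ≈ n^{α-1}`, and `δ ≤ |t| ≤ r`
contributes `O(n^{α-1}) = O((log λ)^{1-1/α})` trivially. A polynomial phase of degree `n`
contributes `O(log n)`, which is smaller: passing from degree `< N` to degree `< 2N` costs `O(1)`,
since the terms of degree in `[N, 2N)` can be dropped below the scale at which the first of them
reaches `1`, and beyond that scale one integrates by parts.

For sharpness, substitute `t = e^{b-u}` in the phase `exp(-A (b - log t)^β)`, `β = α/(α-1)`, which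
vanishes for `t ≤ 0`. At `λ = exp(A U^β)` the integral becomes `∫ (e^{i exp(A(U^β - u^β))} - 1) du`:
the exponential oscillates for `u < U`, leaving `-U + O(1)`, and the integrand is negligible for
`u > U`. Cauchy's estimate on discs of radius comparable to `t`, followed by Young's inequality,
puts the phase in the Denjoy–Carleman class.
-/

noncomputable section

namespace SteinWainger

open MeasureTheory Polynomial

/-! ### Polynomial phases -/

/-- An even majorant of `|s|^{-1/2}` near `0`, integrable over `ℝ` because it decays like
`|s|^{-5/4}` at infinity. -/
def kernel (s : ℝ) : ℝ := min (|s| ^ (-(1 / 2) : ℝ)) (|s| ^ (-(5 / 4) : ℝ))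

theorem kernel_nonneg (s : ℝ) : 0 ≤ kernel s := le_min (by positivity) (by positivity)

theorem kernel_of_mem_Ioc {s : ℝ} (hs : s ∈ Set.Ioc 0 1) : kernel s = s ^ (-(1 / 2) : ℝ) := by
  rw [kernel, abs_of_pos hs.1]
  exact min_eq_left (Real.rpow_le_rpow_of_exponent_ge hs.1 hs.2 (by norm_num))

theorem kernel_of_one_lt {s : ℝ} (hs : 1 < s) : kernel s = s ^ (-(5 / 4) : ℝ) := by
  rw [kernel, abs_of_pos (zero_lt_one.trans hs)]
  exact min_eq_right (Real.rpow_le_rpow_of_exponent_le hs.le (by norm_num))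

theorem integrableOn_Ioi_one_rpow : IntegrableOn (fun t : ℝ => t ^ (-(5 / 4) : ℝ)) (Set.Ioi 1) :=
  integrableOn_Ioi_rpow_of_lt (by norm_num) zero_lt_one

theorem integral_Ioi_one_rpow : ∫ t in Set.Ioi (1 : ℝ), t ^ (-(5 / 4) : ℝ) = 4 := by
  rw [integral_Ioi_rpow_of_lt (by norm_num) zero_lt_one]
  norm_num

theorem integrableOn_kernel_Ioc : IntegrableOn kernel (Set.Ioc 0 1) :=
  ((intervalIntegrable_iff_integrableOn_Ioc_of_le zero_le_one).1
    (intervalIntegral.intervalIntegrable_rpow' (by norm_num))).congr_fun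
    (fun _ hs => (kernel_of_mem_Ioc hs).symm) measurableSet_Ioc

theorem integrableOn_kernel_Ioi_one : IntegrableOn kernel (Set.Ioi 1) :=
  integrableOn_Ioi_one_rpow.congr_fun (fun _ hs => (kernel_of_one_lt hs).symm) measurableSet_Ioi

theorem integral_kernel : ∫ s, kernel s = 12 := by
  have h₀ : ∫ s in Set.Ioc (0 : ℝ) 1, kernel s = 2 := by
    rw [setIntegral_congr_fun measurableSet_Ioc fun _ hs => kernel_of_mem_Ioc hs,
      ← intervalIntegral.integral_of_le zero_le_one, integral_rpow (by norm_num)]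
    norm_num
  have h₁ : ∫ s in Set.Ioi (1 : ℝ), kernel s = 4 := by
    rw [setIntegral_congr_fun measurableSet_Ioi fun _ hs => kernel_of_one_lt hs,
      integral_Ioi_one_rpow]
  have h : ∫ s in Set.Ioi (0 : ℝ), kernel s = 6 := by
    rw [← Set.Ioc_union_Ioi_eq_Ioi zero_le_one, setIntegral_union (Set.Ioc_disjoint_Ioi le_rfl)
      measurableSet_Ioi integrableOn_kernel_Ioc integrableOn_kernel_Ioi_one, h₀, h₁]
    norm_num
  have habs : ∫ s, kernel s = ∫ s, kernel |s| := by simp only [kernel, abs_abs]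
  rw [habs, integral_comp_abs, h]
  norm_num

theorem integrable_kernel : Integrable kernel :=
  .of_integral_ne_zero (by rw [integral_kernel]; norm_num)

theorem rpow_mul_rpow_abs_sub_le {t r : ℝ} (ht : 1 ≤ t) (hr : t ≠ r) :
    t ^ (-(3 / 4) : ℝ) * |t - r| ^ (-(1 / 2) : ℝ) ≤ t ^ (-(5 / 4) : ℝ) + kernel (t - r) := by
  have ht0 : 0 < t := zero_lt_one.trans_le ht
  have hs : 0 < |t - r| := abs_pos.2 (sub_ne_zero.2 hr)
  have hsplit : ∀ x : ℝ, 0 < x → x ^ (-(3 / 4) : ℝ) * x ^ (-(1 / 2) : ℝ) = x ^ (-(5 / 4) : ℝ) :=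
    fun x hx => by rw [← Real.rpow_add hx]; norm_num
  rcases le_total t |t - r| with h | h
  · calc t ^ (-(3 / 4) : ℝ) * |t - r| ^ (-(1 / 2) : ℝ)
        ≤ t ^ (-(3 / 4) : ℝ) * t ^ (-(1 / 2) : ℝ) :=
          mul_le_mul_of_nonneg_left (Real.rpow_le_rpow_of_nonpos ht0 h (by norm_num))
            (by positivity)
      _ = t ^ (-(5 / 4) : ℝ) := hsplit t ht0
      _ ≤ t ^ (-(5 / 4) : ℝ) + kernel (t - r) := le_add_of_nonneg_right (kernel_nonneg _)
  · refine le_add_of_nonneg_of_le (by positivity) (le_min ?_ ?_)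
    · exact mul_le_of_le_one_left (by positivity)
        (Real.rpow_le_one_of_one_le_of_nonpos ht (by norm_num))
    · rw [← hsplit _ hs]
      exact mul_le_mul_of_nonneg_right (Real.rpow_le_rpow_of_nonpos hs h (by norm_num))
        (by positivity)

theorem sqrt_add_div_abs_sub_le {t r : ℝ} (ht : 0 ≤ t) (hr : t ≠ r) :
    √((t + r) / |t - r|) ≤ 1 + 2 * √(t / |t - r|) := by
  have hs : 0 < |t - r| := abs_pos.2 (sub_ne_zero.2 hr)
  have hle : (t + r) / |t - r| ≤ 1 + 2 * (t / |t - r|) := by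
    rw [div_le_iff₀ hs, add_mul, mul_assoc, div_mul_cancel₀ _ hs.ne']
    linarith [neg_abs_le (t - r)]
  refine Real.sqrt_le_iff.2 ⟨by positivity, hle.trans ?_⟩
  nlinarith [Real.sqrt_nonneg (t / |t - r|), Real.sq_sqrt (by positivity : 0 ≤ t / |t - r|)]

theorem rpow_mul_sqrt_add_div_abs_sub_le {t r : ℝ} (ht : 1 ≤ t) (hr : t ≠ r) :
    t ^ (-(5 / 4) : ℝ) * √((t + r) / |t - r|) ≤ 3 * t ^ (-(5 / 4) : ℝ) + 2 * kernel (t - r) := by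
  have ht0 : 0 < t := zero_lt_one.trans_le ht
  have hsqrt : √(t / |t - r|) = t ^ (1 / 2 : ℝ) * |t - r| ^ (-(1 / 2) : ℝ) := by
    rw [Real.sqrt_div ht0.le, Real.sqrt_eq_rpow, Real.sqrt_eq_rpow, Real.rpow_neg (abs_nonneg _),
      div_eq_mul_inv]
  have hpow : t ^ (-(5 / 4) : ℝ) * t ^ (1 / 2 : ℝ) = t ^ (-(3 / 4) : ℝ) := by
    rw [← Real.rpow_add ht0]; norm_num
  calc t ^ (-(5 / 4) : ℝ) * √((t + r) / |t - r|)
      ≤ t ^ (-(5 / 4) : ℝ) * (1 + 2 * √(t / |t - r|)) := by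
        gcongr
        exact sqrt_add_div_abs_sub_le ht0.le hr
    _ = t ^ (-(5 / 4) : ℝ) + 2 * (t ^ (-(3 / 4) : ℝ) * |t - r| ^ (-(1 / 2) : ℝ)) := by
        rw [hsqrt, ← hpow]; ring
    _ ≤ 3 * t ^ (-(5 / 4) : ℝ) + 2 * kernel (t - r) := by
        linarith [rpow_mul_rpow_abs_sub_le ht hr]

theorem intervalIntegrable_rpow_add_kernel {a b : ℝ} (ha : 1 ≤ a) (hab : a ≤ b) (r : ℝ) :
    IntervalIntegrable (fun t => 3 * t ^ (-(5 / 4) : ℝ) + 2 * kernel (t - r)) volume a b := by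
  have hrpow : IntegrableOn (fun t : ℝ => t ^ (-(5 / 4) : ℝ)) (Set.Ioc a b) :=
    integrableOn_Ioi_one_rpow.mono_set fun t ht => ha.trans_lt ht.1
  exact (((intervalIntegrable_iff_integrableOn_Ioc_of_le hab).2 hrpow).const_mul 3).add
    ((integrable_kernel.comp_sub_right r).const_mul 2).intervalIntegrable

theorem integral_rpow_add_kernel_le {a b : ℝ} (ha : 1 ≤ a) (hab : a ≤ b) (r : ℝ) :
    ∫ t in a..b, (3 * t ^ (-(5 / 4) : ℝ) + 2 * kernel (t - r)) ≤ 36 := by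
  have hsub : Set.Ioc a b ⊆ Set.Ioi 1 := fun t ht => ha.trans_lt ht.1
  have hkernel := integrable_kernel.comp_sub_right r
  have h₁ : ∫ t in Set.Ioc a b, t ^ (-(5 / 4) : ℝ) ≤ 4 := by
    refine (setIntegral_mono_set integrableOn_Ioi_one_rpow ?_ hsub.eventuallyLE).trans_eq
      integral_Ioi_one_rpow
    filter_upwards [ae_restrict_mem measurableSet_Ioi] with t ht
    exact Real.rpow_nonneg (zero_le_one.trans (le_of_lt ht)) _
  have h₂ : ∫ t in Set.Ioc a b, kernel (t - r) ≤ 12 := by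
    rw [← integral_kernel, ← integral_sub_right_eq_self kernel r]
    exact setIntegral_le_integral hkernel (ae_of_all _ fun t => kernel_nonneg _)
  rw [intervalIntegral.integral_of_le hab,
    integral_add ((integrableOn_Ioi_one_rpow.mono_set hsub).const_mul 3)
      (hkernel.const_mul 2).integrableOn, integral_const_mul, integral_const_mul]
  linarith

theorem integral_abs_deriv_le_of_forall_ne_zero {f f' : ℝ → ℝ} {a b B : ℝ} (hab : a ≤ b)
    (hf : ∀ x ∈ Set.Icc a b, HasDerivAt f (f' x) x) (hf' : ContinuousOn f' (Set.Icc a b))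
    (hB : ∀ x ∈ Set.Icc a b, |f x| ≤ B) (h₀ : ∀ x ∈ Set.Ioo a b, f' x ≠ 0) :
    ∫ x in a..b, |f' x| ≤ 2 * B := by
  have hftc : ∫ x in a..b, f' x = f b - f a := by
    rw [← Set.uIcc_of_le hab] at hf hf'
    exact intervalIntegral.integral_eq_sub_of_hasDerivAt hf hf'.intervalIntegrable
  have hdiff : |f b - f a| ≤ 2 * B := by
    linarith [abs_sub (f b) (f a), hB a (Set.left_mem_Icc.2 hab), hB b (Set.right_mem_Icc.2 hab)]
  have hsign : (∀ x ∈ Set.Ioo a b, 0 ≤ f' x) ∨ ∀ x ∈ Set.Ioo a b, f' x ≤ 0 := by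
    by_contra! hcon
    obtain ⟨⟨x, hx, hx0⟩, y, hy, hy0⟩ := hcon
    have hsub : Set.uIcc x y ⊆ Set.Ioo a b := Set.ordConnected_Ioo.uIcc_subset hx hy
    obtain ⟨c, hc, hc0⟩ : (0 : ℝ) ∈ f' '' Set.uIcc x y :=
      intermediate_value_uIcc (hf'.mono (hsub.trans Set.Ioo_subset_Icc_self))
        (Set.mem_uIcc.2 (Or.inl ⟨hx0.le, hy0.le⟩))
    exact h₀ c (hsub hc) hc0
  rcases hsign with h | h
  · rw [intervalIntegral.integral_congr_Ioo_of_le hab fun x hx => abs_of_nonneg (h x hx), hftc]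
    exact (le_abs_self _).trans hdiff
  · rw [intervalIntegral.integral_congr_Ioo_of_le hab fun x hx => abs_of_nonpos (h x hx),
      intervalIntegral.integral_neg, hftc]
    exact (neg_le_abs _).trans hdiff

theorem card_filter_lt_add_card_filter_gt_lt {ι : Type*} [LinearOrder ι] {S : Finset ι} {c : ι}
    (hc : c ∈ S) : (S.filter (· < c)).card + (S.filter (c < ·)).card < S.card := by
  rw [← Finset.card_union_of_disjoint
    (Finset.disjoint_filter.2 fun x _ h₁ h₂ => lt_asymm h₁ h₂), ← Finset.filter_or]
  exact Finset.card_lt_card (Finset.filter_ssubset.2 ⟨c, hc, by simp⟩)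

theorem integral_abs_deriv_le {f f' : ℝ → ℝ} {a b B : ℝ} (hab : a ≤ b)
    (hf : ∀ x ∈ Set.Icc a b, HasDerivAt f (f' x) x) (hf' : ContinuousOn f' (Set.Icc a b))
    (hB : ∀ x ∈ Set.Icc a b, |f x| ≤ B) (S : Finset ℝ) (hS : ∀ x ∈ Set.Ioo a b, f' x = 0 → x ∈ S) :
    ∫ x in a..b, |f' x| ≤ 2 * B * (S.card + 1) := by
  have hB0 : 0 ≤ B := (abs_nonneg _).trans (hB a (Set.left_mem_Icc.2 hab))
  induction S using Finset.strongInduction generalizing a b with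
  | H S ih =>
    by_cases hzero : ∃ c ∈ Set.Ioo a b, f' c = 0
    · obtain ⟨c, hc, hc0⟩ := hzero
      have hcS : c ∈ S := hS c hc hc0
      have hac : Set.Icc a c ⊆ Set.Icc a b := Set.Icc_subset_Icc_right hc.2.le
      have hcb : Set.Icc c b ⊆ Set.Icc a b := Set.Icc_subset_Icc_left hc.1.le
      have hleft := ih (S.filter (· < c)) (Finset.filter_ssubset.2 ⟨c, hcS, lt_irrefl c⟩) hc.1.le
        (fun x hx => hf x (hac hx)) (hf'.mono hac) (fun x hx => hB x (hac hx))
        fun x hx h => Finset.mem_filter.2 ⟨hS x ⟨hx.1, hx.2.trans hc.2⟩ h, hx.2⟩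
      have hright := ih (S.filter (c < ·)) (Finset.filter_ssubset.2 ⟨c, hcS, lt_irrefl c⟩) hc.2.le
        (fun x hx => hf x (hcb hx)) (hf'.mono hcb) (fun x hx => hB x (hcb hx))
        fun x hx h => Finset.mem_filter.2 ⟨hS x ⟨hc.1.trans hx.1, hx.2⟩ h, hx.1⟩
      have hcard : ((S.filter (· < c)).card : ℝ) + (S.filter (c < ·)).card + 1 ≤ S.card := by
        exact_mod_cast card_filter_lt_add_card_filter_gt_lt hcS
      rw [← intervalIntegral.integral_add_adjacent_intervals
        ((hf'.mono hac).abs.intervalIntegrable_of_Icc hc.1.le)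
        ((hf'.mono hcb).abs.intervalIntegrable_of_Icc hc.2.le)]
      nlinarith
    · push Not at hzero
      refine (integral_abs_deriv_le_of_forall_ne_zero hab hf hf' hB hzero).trans ?_
      exact le_mul_of_one_le_right (by positivity) (by simp)

theorem C_leadingCoeff_mul_prod_roots (p : ℂ[X]) :
    C p.leadingCoeff * ∏ z : p.roots, (X - C z.1) = p := by
  conv_rhs => rw [(IsAlgClosed.splits p).eq_prod_roots]
  rw [Finset.prod_eq_multiset_prod, Multiset.map_univ p.roots fun z => X - C z]

theorem card_roots_eq_natDegree (p : ℂ[X]) : Fintype.card p.roots = p.natDegree := by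
  rw [Multiset.card_coe, ← (IsAlgClosed.splits p).natDegree_eq_card_roots]

theorem norm_leadingCoeff_mul_prod_abs_sub_le (p : ℂ[X]) {t : ℝ} (ht : 0 ≤ t) :
    ‖p.leadingCoeff‖ * ∏ z : p.roots, |t - ‖z.1‖| ≤ ‖p.eval (t : ℂ)‖ := by
  have heval : ‖p.eval (t : ℂ)‖ = ‖p.leadingCoeff‖ * ∏ z : p.roots, ‖(t : ℂ) - z.1‖ := by
    conv_lhs => rw [← C_leadingCoeff_mul_prod_roots p]
    simp only [eval_mul, eval_C, eval_prod, eval_sub, eval_X, norm_mul, norm_prod]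
  rw [heval]
  gcongr with z
  simpa only [Complex.norm_real, Real.norm_of_nonneg ht] using abs_norm_sub_norm_le (t : ℂ) z.1

theorem norm_coeff_prod_X_sub_C_mul_pow_le {R ι : Type*} [NormedCommRing R] [NormOneClass R]
    (s : Finset ι) (z : ι → R) {t : ℝ} (ht : 0 ≤ t) (j : ℕ) :
    ‖(∏ i ∈ s, (X - C (z i))).coeff j‖ * t ^ j ≤ ∏ i ∈ s, (t + ‖z i‖) := by
  classical
  induction s using Finset.induction_on generalizing j with
  | empty =>
    rcases eq_or_ne j 0 with rfl | hj
    · simp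
    · simp [coeff_one, hj]
  | insert i s hi ih =>
    rw [Finset.prod_insert hi, Finset.prod_insert hi, sub_mul, coeff_sub, coeff_C_mul, add_mul]
    set Q := ∏ i ∈ s, (X - C (z i))
    have hC : ∀ k, ‖z i * Q.coeff k‖ * t ^ k ≤ ‖z i‖ * ∏ i ∈ s, (t + ‖z i‖) := fun k =>
      calc ‖z i * Q.coeff k‖ * t ^ k ≤ ‖z i‖ * ‖Q.coeff k‖ * t ^ k := by
            gcongr
            exact norm_mul_le _ _
        _ ≤ ‖z i‖ * ∏ i ∈ s, (t + ‖z i‖) := by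
            rw [mul_assoc]
            exact mul_le_mul_of_nonneg_left (ih k) (norm_nonneg _)
    cases j with
    | zero =>
      rw [coeff_X_mul_zero, zero_sub, norm_neg]
      exact (hC 0).trans (le_add_of_nonneg_left
        (mul_nonneg ht (Finset.prod_nonneg fun i _ => by positivity)))
    | succ j =>
      rw [coeff_X_mul]
      calc ‖Q.coeff j - z i * Q.coeff (j + 1)‖ * t ^ (j + 1)
          ≤ (‖Q.coeff j‖ + ‖z i * Q.coeff (j + 1)‖) * t ^ (j + 1) := by
            gcongr
            exact norm_sub_le _ _
        _ = t * (‖Q.coeff j‖ * t ^ j) + ‖z i * Q.coeff (j + 1)‖ * t ^ (j + 1) := by ring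
        _ ≤ t * ∏ i ∈ s, (t + ‖z i‖) + ‖z i‖ * ∏ i ∈ s, (t + ‖z i‖) :=
            add_le_add (mul_le_mul_of_nonneg_left (ih j) ht) (hC (j + 1))

theorem norm_coeff_mul_pow_le_norm_eval_mul_prod (p : ℂ[X]) {t : ℝ} (ht : 0 ≤ t)
    (hz : ∀ z : p.roots, t ≠ ‖z.1‖) (j : ℕ) :
    ‖p.coeff j‖ * t ^ j ≤ ‖p.eval (t : ℂ)‖ * ∏ z : p.roots, (t + ‖z.1‖) / |t - ‖z.1‖| := by
  have hpos : 0 < ∏ z : p.roots, |t - ‖z.1‖| :=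
    Finset.prod_pos fun z _ => abs_pos.2 (sub_ne_zero.2 (hz z))
  have : 0 ≤ ∏ z : p.roots, (t + ‖z.1‖) := Finset.prod_nonneg fun z _ => by positivity
  calc ‖p.coeff j‖ * t ^ j
      = ‖p.leadingCoeff‖ * (‖(∏ z : p.roots, (X - C z.1)).coeff j‖ * t ^ j) := by
        conv_lhs => rw [← C_leadingCoeff_mul_prod_roots p]
        rw [coeff_C_mul, norm_mul, mul_assoc]
    _ ≤ ‖p.leadingCoeff‖ * ∏ z : p.roots, (t + ‖z.1‖) := by
        gcongr
        exact norm_coeff_prod_X_sub_C_mul_pow_le _ (fun z : p.roots => z.1) ht j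
    _ = ‖p.leadingCoeff‖ * (∏ z : p.roots, |t - ‖z.1‖|) *
          ∏ z : p.roots, (t + ‖z.1‖) / |t - ‖z.1‖| := by
        rw [Finset.prod_div_distrib]
        field_simp
    _ ≤ ‖p.eval (t : ℂ)‖ * ∏ z : p.roots, (t + ‖z.1‖) / |t - ‖z.1‖| := by
        rw [Finset.prod_div_distrib]
        gcongr
        exact norm_leadingCoeff_mul_prod_abs_sub_le p ht

theorem prod_rpow_le_sum_sqrt {ι : Type*} [Fintype ι] [Nonempty ι] {x : ι → ℝ}
    (hx : ∀ i, 0 ≤ x i) :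
    (∏ i, x i) ^ (1 / (2 * Fintype.card ι) : ℝ) ≤ ∑ i, (Fintype.card ι : ℝ)⁻¹ * √(x i) := by
  have hcard : (Fintype.card ι : ℝ) ≠ 0 := Nat.cast_ne_zero.2 Fintype.card_ne_zero
  calc (∏ i, x i) ^ (1 / (2 * Fintype.card ι) : ℝ)
      = ∏ i, √(x i) ^ (Fintype.card ι : ℝ)⁻¹ := by
        rw [← Real.finsetProd_rpow _ _ fun i _ => hx i]
        refine Finset.prod_congr rfl fun i _ => ?_
        rw [Real.sqrt_eq_rpow, ← Real.rpow_mul (hx i)]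
        congr 1
        field_simp
    _ ≤ ∑ i, (Fintype.card ι : ℝ)⁻¹ * √(x i) :=
        Real.geom_mean_le_arith_mean_weighted _ _ _ (fun i _ => by positivity)
          (by simp [hcard]) fun i _ => Real.sqrt_nonneg _

theorem sq_div_sq_add_sq_le_rpow {x δ θ : ℝ} (hx : 0 < x) (hδ : 0 < δ) (hθ₀ : 0 ≤ θ)
    (hθ₁ : θ ≤ 1) : δ ^ 2 / (x ^ 2 + δ ^ 2) ≤ (δ / x) ^ θ := by
  rcases le_total x δ with h | h
  · calc δ ^ 2 / (x ^ 2 + δ ^ 2) ≤ 1 := by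
          rw [div_le_one (by positivity)]
          exact le_add_of_nonneg_left (sq_nonneg x)
      _ ≤ (δ / x) ^ θ := Real.one_le_rpow (by rwa [one_le_div hx]) hθ₀
  · calc δ ^ 2 / (x ^ 2 + δ ^ 2) ≤ δ ^ 2 / x ^ 2 := by
          gcongr
          exact le_add_of_nonneg_right (sq_nonneg δ)
      _ = (δ / x) ^ (2 : ℝ) := by rw [Real.rpow_two, div_pow]
      _ ≤ (δ / x) ^ θ := Real.rpow_le_rpow_of_exponent_ge (by positivity) (by rwa [div_le_one hx])
          (hθ₁.trans one_le_two)

theorem two_mul_rpow_neg_rpow_le {n s t : ℝ} (hn : 1 ≤ n) (hns : n ≤ 2 * s) (ht : 1 ≤ t) :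
    (2 * t ^ (-s)) ^ (1 / (2 * n)) ≤ 2 * t ^ (-(1 / 4) : ℝ) := by
  have ht0 : 0 < t := zero_lt_one.trans_le ht
  have hθ : 1 / (2 * n) ≤ 1 := by
    rw [div_le_one (by positivity)]
    linarith
  rw [Real.mul_rpow (by norm_num) (by positivity), ← Real.rpow_mul ht0.le]
  gcongr
  · exact Real.rpow_le_self_of_one_le one_le_two hθ
  · rw [neg_mul, neg_le_neg_iff, mul_one_div, le_div_iff₀ (by positivity)]
    linarith

theorem sq_div_norm_eval_sq_add_sq_le {p : ℂ[X]} {j : ℕ} (hdeg : p.natDegree ≤ 2 * j)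
    [Nonempty p.roots] {δ : ℝ} (hδ : 0 < δ) (hδp : δ ≤ 2 * ‖p.coeff j‖) {t : ℝ} (ht : 1 ≤ t)
    (hz : ∀ z : p.roots, t ≠ ‖z.1‖) :
    δ ^ 2 / (‖p.eval (t : ℂ)‖ ^ 2 + δ ^ 2) ≤ 2 * t ^ (-(1 / 4) : ℝ) *
      ∑ z : p.roots, (Fintype.card p.roots : ℝ)⁻¹ * √((t + ‖z.1‖) / |t - ‖z.1‖|) := by
  have ht0 : 0 < t := zero_lt_one.trans_le ht
  set x : ℝ := ‖p.eval (t : ℂ)‖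
  set ρ : p.roots → ℝ := fun z => (t + ‖z.1‖) / |t - ‖z.1‖|
  have hρ : ∀ z, 0 ≤ ρ z := fun z => by positivity
  have hratio : ‖p.coeff j‖ * t ^ j ≤ x * ∏ z, ρ z :=
    norm_coeff_mul_pow_le_norm_eval_mul_prod p ht0.le hz j
  have hx : 0 < x := pos_of_mul_pos_left
    ((mul_pos (by linarith) (by positivity)).trans_le hratio) (Finset.prod_nonneg fun z _ => hρ z)
  have hnj : (Fintype.card p.roots : ℝ) ≤ 2 * j := by
    rw [card_roots_eq_natDegree]
    exact_mod_cast hdeg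
  set n := (Fintype.card p.roots : ℝ)
  have hn : 1 ≤ n := Nat.one_le_cast.2 Fintype.card_pos
  have hθ₁ : 1 / (2 * n) ≤ 1 := by
    rw [div_le_one (by positivity)]
    linarith
  have hδx : δ / x ≤ 2 * t ^ (-(j : ℝ)) * ∏ z, ρ z := by
    rw [div_le_iff₀ hx, Real.rpow_neg ht0.le, Real.rpow_natCast]
    calc δ ≤ 2 * (t ^ j)⁻¹ * (‖p.coeff j‖ * t ^ j) := by
          field_simp
          linarith
      _ ≤ 2 * (t ^ j)⁻¹ * (x * ∏ z, ρ z) := by gcongr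
      _ = 2 * (t ^ j)⁻¹ * (∏ z, ρ z) * x := by ring
  calc δ ^ 2 / (x ^ 2 + δ ^ 2)
      ≤ (δ / x) ^ (1 / (2 * n)) := sq_div_sq_add_sq_le_rpow hx hδ (by positivity) hθ₁
    _ ≤ (2 * t ^ (-(j : ℝ)) * ∏ z, ρ z) ^ (1 / (2 * n)) := by gcongr
    _ = (2 * t ^ (-(j : ℝ))) ^ (1 / (2 * n)) * (∏ z, ρ z) ^ (1 / (2 * n)) :=
        Real.mul_rpow (by positivity) (Finset.prod_nonneg fun z _ => hρ z)
    _ ≤ 2 * t ^ (-(1 / 4) : ℝ) * ∑ z, n⁻¹ * √(ρ z) := by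
        gcongr
        · exact two_mul_rpow_neg_rpow_le hn hnj ht
        · exact prod_rpow_le_sum_sqrt hρ

theorem integral_average_rpow_add_kernel_le {ι : Type*} [Fintype ι] [Nonempty ι] (r : ι → ℝ)
    {a b : ℝ} (ha : 1 ≤ a) (hab : a ≤ b) :
    ∫ t in a..b, ∑ i, (Fintype.card ι : ℝ)⁻¹ * (3 * t ^ (-(5 / 4) : ℝ) + 2 * kernel (t - r i)) ≤
      36 := by
  rw [intervalIntegral.integral_finsetSum fun i _ =>
    (intervalIntegrable_rpow_add_kernel ha hab (r i)).const_mul _]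
  simp only [intervalIntegral.integral_const_mul]
  calc ∑ i, (Fintype.card ι : ℝ)⁻¹ *
        ∫ t in a..b, (3 * t ^ (-(5 / 4) : ℝ) + 2 * kernel (t - r i))
      ≤ ∑ _i : ι, (Fintype.card ι : ℝ)⁻¹ * 36 := by
        gcongr with i
        exact integral_rpow_add_kernel_le ha hab (r i)
    _ = 36 := by
        rw [Finset.sum_const, Finset.card_univ, nsmul_eq_mul, mul_inv_cancel_left₀]
        exact Nat.cast_ne_zero.2 Fintype.card_ne_zero

theorem sq_div_norm_eval_sq_add_sq_div_le {p : ℂ[X]} {j : ℕ} (hdeg : p.natDegree ≤ 2 * j)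
    [Nonempty p.roots] {δ : ℝ} (hδ : 0 < δ) (hδp : δ ≤ 2 * ‖p.coeff j‖) {t : ℝ} (ht : 1 ≤ t)
    (hz : ∀ z : p.roots, t ≠ ‖z.1‖) :
    δ ^ 2 / (‖p.eval (t : ℂ)‖ ^ 2 + δ ^ 2) / t ≤ 2 * ∑ z : p.roots,
      (Fintype.card p.roots : ℝ)⁻¹ * (3 * t ^ (-(5 / 4) : ℝ) + 2 * kernel (t - ‖z.1‖)) := by
  have ht0 : 0 < t := zero_lt_one.trans_le ht
  have hpow : t ^ (-(1 / 4) : ℝ) / t = t ^ (-(5 / 4) : ℝ) := by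
    rw [← Real.rpow_sub_one ht0.ne']
    norm_num
  calc δ ^ 2 / (‖p.eval (t : ℂ)‖ ^ 2 + δ ^ 2) / t
      ≤ 2 * t ^ (-(1 / 4) : ℝ) * (∑ z : p.roots, (Fintype.card p.roots : ℝ)⁻¹ *
          √((t + ‖z.1‖) / |t - ‖z.1‖|)) / t := by
        gcongr
        exact sq_div_norm_eval_sq_add_sq_le hdeg hδ hδp ht hz
    _ = 2 * ∑ z : p.roots, (Fintype.card p.roots : ℝ)⁻¹ *
          (t ^ (-(5 / 4) : ℝ) * √((t + ‖z.1‖) / |t - ‖z.1‖|)) := by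
        rw [← hpow, Finset.mul_sum, Finset.mul_sum, Finset.sum_div]
        exact Finset.sum_congr rfl fun z _ => by ring
    _ ≤ 2 * ∑ z : p.roots, (Fintype.card p.roots : ℝ)⁻¹ *
          (3 * t ^ (-(5 / 4) : ℝ) + 2 * kernel (t - ‖z.1‖)) := by
        gcongr with z
        exact rpow_mul_sqrt_add_div_abs_sub_le ht (hz z)

theorem integral_sq_div_norm_eval_sq_add_sq_le {p : ℂ[X]} {j : ℕ} (hdeg : p.natDegree ≤ 2 * j)
    (hj : 0 < j) {δ : ℝ} (hδ : 0 < δ) (hδp : δ ≤ 2 * ‖p.coeff j‖) {a b : ℝ} (ha : 1 ≤ a)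
    (hab : a ≤ b) : ∫ t in a..b, δ ^ 2 / (‖p.eval (t : ℂ)‖ ^ 2 + δ ^ 2) / t ≤ 72 := by
  have hcoeff : p.coeff j ≠ 0 := norm_pos_iff.1 (by linarith)
  have : Nonempty p.roots := by
    rw [← Fintype.card_pos_iff, card_roots_eq_natDegree]
    exact hj.trans_le (le_natDegree_of_ne_zero hcoeff)
  have hae : ∀ᵐ t : ℝ, ∀ z : p.roots, t ≠ ‖z.1‖ := ae_all_iff.2 fun z => Measure.ae_ne volume _
  have hcont : ContinuousOn (fun t : ℝ => δ ^ 2 / (‖p.eval (t : ℂ)‖ ^ 2 + δ ^ 2) / t)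
      (Set.uIcc a b) := by
    rw [Set.uIcc_of_le hab]
    have : ∀ t ∈ Set.Icc a b, t ≠ 0 := fun t ht => (zero_lt_one.trans_le (ha.trans ht.1)).ne'
    have : ∀ t : ℝ, ‖p.eval (t : ℂ)‖ ^ 2 + δ ^ 2 ≠ 0 := fun t => by positivity
    fun_prop (disch := simp_all)
  have hint : IntervalIntegrable (fun t => ∑ z : p.roots, (Fintype.card p.roots : ℝ)⁻¹ *
      (3 * t ^ (-(5 / 4) : ℝ) + 2 * kernel (t - ‖z.1‖))) volume a b := by
    simpa only [Finset.sum_fn] using IntervalIntegrable.sum Finset.univ fun (z : p.roots) _ =>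
      (intervalIntegrable_rpow_add_kernel ha hab ‖z.1‖).const_mul
        (Fintype.card p.roots : ℝ)⁻¹
  calc ∫ t in a..b, δ ^ 2 / (‖p.eval (t : ℂ)‖ ^ 2 + δ ^ 2) / t
      ≤ ∫ t in a..b, 2 * ∑ z : p.roots, (Fintype.card p.roots : ℝ)⁻¹ *
          (3 * t ^ (-(5 / 4) : ℝ) + 2 * kernel (t - ‖z.1‖)) := by
        refine intervalIntegral.integral_mono_ae_restrict hab hcont.intervalIntegrable
          (hint.const_mul 2) ?_
        filter_upwards [ae_restrict_of_ae hae, ae_restrict_mem measurableSet_Icc] with t hz ht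
        exact sq_div_norm_eval_sq_add_sq_div_le hdeg hδ hδp (ha.trans ht.1) hz
    _ ≤ 72 := by
        rw [intervalIntegral.integral_const_mul]
        linarith [integral_average_rpow_add_kernel_le (fun z : p.roots => ‖z.1‖) ha hab]

/-- The unimodular exponential `e^{ix}` of a real number. -/
def expI (x : ℝ) : ℂ := Complex.exp (Complex.I * x)

theorem norm_expI (x : ℝ) : ‖expI x‖ = 1 := Complex.norm_exp_I_mul_ofReal x

@[fun_prop]
theorem continuous_expI : Continuous expI := by
  unfold expI
  fun_prop

theorem norm_expI_sub_expI_le (x y : ℝ) : ‖expI x - expI y‖ ≤ |x - y| := by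
  have hfactor : expI x - expI y = expI y * (Complex.exp (Complex.I * (x - y : ℝ)) - 1) := by
    rw [expI, expI, mul_sub_one, ← Complex.exp_add]
    push_cast
    ring_nf
  rw [hfactor, norm_mul, norm_expI, one_mul]
  exact Real.norm_exp_I_mul_ofReal_sub_one_le

theorem norm_expI_sub_expI_le_two (x y : ℝ) : ‖expI x - expI y‖ ≤ 2 :=
  (norm_sub_le _ _).trans_eq (by rw [norm_expI, norm_expI]; norm_num)

theorem hasDerivAt_expI_comp {φ : ℝ → ℝ} {φ' t : ℝ} (h : HasDerivAt φ φ' t) :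
    HasDerivAt (fun t => expI (φ t)) (expI (φ t) * (Complex.I * φ')) t :=
  (h.ofReal_comp.const_mul Complex.I).cexp

theorem norm_integral_mul_expI_le (g φ : ℝ → ℝ) {a b : ℝ} (hab : a ≤ b) :
    ‖∫ t in a..b, (g t : ℂ) * expI (φ t)‖ ≤ ∫ t in a..b, |g t| := by
  refine (intervalIntegral.norm_integral_le_integral_norm hab).trans_eq ?_
  simp only [norm_mul, norm_expI, mul_one, Complex.norm_real, Real.norm_eq_abs]

theorem norm_integral_mul_deriv_mul_expI_le {f f' φ φ' : ℝ → ℝ} {a b : ℝ} (hab : a ≤ b)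
    (hf : ∀ t ∈ Set.Icc a b, HasDerivAt f (f' t) t) (hf' : ContinuousOn f' (Set.Icc a b))
    (hφ : ∀ t ∈ Set.Icc a b, HasDerivAt φ (φ' t) t) (hφ' : ContinuousOn φ' (Set.Icc a b)) :
    ‖∫ t in a..b, ((f t * φ' t : ℝ) : ℂ) * expI (φ t)‖ ≤ |f a| + |f b| + ∫ t in a..b, |f' t| := by
  have hE : ∀ t ∈ Set.Icc a b,
      HasDerivAt (fun t => expI (φ t)) (expI (φ t) * (Complex.I * φ' t)) t :=
    fun t ht => hasDerivAt_expI_comp (hφ t ht)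
  have hE' : ContinuousOn (fun t => expI (φ t) * (Complex.I * φ' t)) (Set.Icc a b) := by
    have hφc : ContinuousOn φ (Set.Icc a b) := fun t ht => (hφ t ht).continuousAt.continuousWithinAt
    fun_prop
  have hparts : ∫ t in a..b, (f t : ℂ) * (expI (φ t) * (Complex.I * φ' t)) =
      f b * expI (φ b) - f a * expI (φ a) - ∫ t in a..b, (f' t : ℂ) * expI (φ t) := by
    refine intervalIntegral.integral_mul_deriv_eq_deriv_mul (u := fun t => (f t : ℂ))
      (u' := fun t => (f' t : ℂ)) (fun t ht => ?_) (fun t ht => hE t ?_)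
      (ContinuousOn.intervalIntegrable ?_) (hE'.intervalIntegrable_of_Icc hab) <;>
      rw [Set.uIcc_of_le hab] at *
    · exact (hf t ht).ofReal_comp
    · exact ht
    · fun_prop
  have hfactor : ∫ t in a..b, ((f t * φ' t : ℝ) : ℂ) * expI (φ t) =
      -Complex.I * ∫ t in a..b, (f t : ℂ) * (expI (φ t) * (Complex.I * φ' t)) := by
    rw [← intervalIntegral.integral_const_mul]
    refine intervalIntegral.integral_congr fun t _ => ?_
    push_cast
    linear_combination (f t * φ' t * expI (φ t) : ℂ) * Complex.I_sq
  have hend : ∀ t, ‖(f t : ℂ) * expI (φ t)‖ = |f t| := fun t => by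
    rw [norm_mul, norm_expI, mul_one, Complex.norm_real, Real.norm_eq_abs]
  rw [hfactor, hparts, norm_mul, norm_neg, Complex.norm_I, one_mul]
  refine (norm_sub_le _ _).trans (add_le_add ((norm_sub_le _ _).trans_eq ?_)
    (norm_integral_mul_expI_le f' φ hab))
  rw [hend, hend, add_comm]

theorem integral_sq_div_eval_sq_add_sq_le {q : ℝ[X]} {j : ℕ} (hdeg : q.natDegree ≤ 2 * j)
    (hj : 0 < j) {δ : ℝ} (hδ : 0 < δ) (hδq : δ ≤ 2 * |q.coeff j|) {a b : ℝ} (ha : 1 ≤ a)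
    (hab : a ≤ b) : ∫ t in a..b, δ ^ 2 / (q.eval t ^ 2 + δ ^ 2) / t ≤ 72 := by
  have heval : ∀ t : ℝ, ‖(q.map (algebraMap ℝ ℂ)).eval (t : ℂ)‖ ^ 2 = q.eval t ^ 2 := fun t => by
    rw [eval_map, ← Complex.coe_algebraMap, eval₂_at_apply, norm_algebraMap', Real.norm_eq_abs,
      sq_abs]
  simp only [← heval]
  refine integral_sq_div_norm_eval_sq_add_sq_le (natDegree_map_le.trans hdeg) hj hδ ?_ ha hab
  rwa [coeff_map, norm_algebraMap', Real.norm_eq_abs]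

theorem abs_div_sq_add_sq_le (x : ℝ) {δ : ℝ} (hδ : 0 < δ) :
    |x / (x ^ 2 + δ ^ 2)| ≤ 1 / (2 * δ) := by
  have hpos : 0 < x ^ 2 + δ ^ 2 := by positivity
  rw [abs_div, abs_of_pos hpos, div_le_div_iff₀ hpos (by positivity)]
  linarith [two_mul_le_add_sq |x| δ, sq_abs x]

theorem hasDerivAt_eval_div_sq_add_sq (q : ℝ[X]) {δ : ℝ} (hδ : 0 < δ) (t : ℝ) :
    HasDerivAt (fun t => q.eval t / (q.eval t ^ 2 + δ ^ 2))
      ((derivative q * (C (δ ^ 2) - q ^ 2)).eval t / (q.eval t ^ 2 + δ ^ 2) ^ 2) t := by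
  have hden : q.eval t ^ 2 + δ ^ 2 ≠ 0 := by positivity
  refine ((q.hasDerivAt t).div (((q.hasDerivAt t).pow 2).add_const (δ ^ 2)) hden).congr_deriv ?_
  simp only [eval_mul, eval_sub, eval_C, eval_pow, Nat.cast_ofNat, Pi.pow_apply]
  ring

theorem continuous_eval_div_sq_add_sq_sq (N q : ℝ[X]) {δ : ℝ} (hδ : 0 < δ) :
    Continuous fun t => N.eval t / (q.eval t ^ 2 + δ ^ 2) ^ 2 :=
  N.continuous.div (((q.continuous.pow 2).add continuous_const).pow 2) fun t => by positivity

theorem natDegree_derivative_mul_C_sub_sq_le (q : ℝ[X]) (c : ℝ) :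
    (derivative q * (C c - q ^ 2)).natDegree ≤ 3 * q.natDegree := by
  have hderiv : (derivative q).natDegree ≤ q.natDegree :=
    (natDegree_derivative_le q).trans (Nat.sub_le _ _)
  have hsq : (C c - q ^ 2).natDegree ≤ 2 * q.natDegree := by
    rw [natDegree_sub, natDegree_sub_C]
    exact natDegree_pow_le
  exact natDegree_mul_le.trans (by omega)

theorem integral_abs_deriv_eval_div_le (q : ℝ[X]) {δ : ℝ} (hδ : 0 < δ) {a b : ℝ} (hab : a ≤ b) :
    ∫ t in a..b, |(derivative q * (C (δ ^ 2) - q ^ 2)).eval t / (q.eval t ^ 2 + δ ^ 2) ^ 2| ≤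
      (3 * q.natDegree + 1) / δ := by
  set N := derivative q * (C (δ ^ 2) - q ^ 2)
  rcases eq_or_ne N 0 with hN | hN
  · simp only [hN, eval_zero, zero_div, abs_zero, intervalIntegral.integral_zero]
    positivity
  have hzeros : ∀ x, N.eval x / (q.eval x ^ 2 + δ ^ 2) ^ 2 = 0 → x ∈ N.roots.toFinset :=
    fun x hx => by
      have hden : (q.eval x ^ 2 + δ ^ 2) ^ 2 ≠ 0 := by positivity
      rw [div_eq_zero_iff, or_iff_left hden] at hx
      exact Multiset.mem_toFinset.2 ((mem_roots hN).2 hx)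
  have hcard : (N.roots.toFinset.card : ℝ) ≤ 3 * q.natDegree := by
    exact_mod_cast (Multiset.toFinset_card_le _).trans
      ((card_roots' N).trans (natDegree_derivative_mul_C_sub_sq_le q (δ ^ 2)))
  calc ∫ t in a..b, |N.eval t / (q.eval t ^ 2 + δ ^ 2) ^ 2|
      ≤ 2 * (1 / (2 * δ)) * (N.roots.toFinset.card + 1) :=
        integral_abs_deriv_le hab (fun t _ => hasDerivAt_eval_div_sq_add_sq q hδ t)
          (continuous_eval_div_sq_add_sq_sq N q hδ).continuousOn
          (fun t _ => abs_div_sq_add_sq_le (q.eval t) hδ) _ fun x _ => hzeros x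
    _ ≤ 2 * (1 / (2 * δ)) * (3 * q.natDegree + 1) := by gcongr
    _ = (3 * q.natDegree + 1) / δ := by field_simp

theorem norm_integral_eval_div_mul_deriv_mul_expI_le {P q : ℝ[X]} (hP : 0 < P.natDegree)
    (hq : q.natDegree ≤ P.natDegree) {a b : ℝ} (hab : a ≤ b) :
    ‖∫ t in a..b, ((q.eval t / (q.eval t ^ 2 + (P.natDegree : ℝ) ^ 2) *
      (derivative P).eval t : ℝ) : ℂ) * expI (P.eval t)‖ ≤ 5 := by
  set δ := (P.natDegree : ℝ)
  have hδ₁ : 1 ≤ δ := Nat.one_le_cast.2 hP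
  have hδ : 0 < δ := zero_lt_one.trans_le hδ₁
  have hqδ : (q.natDegree : ℝ) ≤ δ := Nat.cast_le.2 hq
  calc ‖∫ t in a..b, ((q.eval t / (q.eval t ^ 2 + δ ^ 2) * (derivative P).eval t : ℝ) : ℂ) *
        expI (P.eval t)‖
      ≤ |q.eval a / (q.eval a ^ 2 + δ ^ 2)| + |q.eval b / (q.eval b ^ 2 + δ ^ 2)| +
          ∫ t in a..b, |(derivative q * (C (δ ^ 2) - q ^ 2)).eval t /
            (q.eval t ^ 2 + δ ^ 2) ^ 2| :=
        norm_integral_mul_deriv_mul_expI_le hab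
          (fun t _ => hasDerivAt_eval_div_sq_add_sq q hδ t)
          (continuous_eval_div_sq_add_sq_sq _ q hδ).continuousOn (fun t _ => P.hasDerivAt t)
          (derivative P).continuous.continuousOn
    _ ≤ 1 / (2 * δ) + 1 / (2 * δ) + (3 * q.natDegree + 1) / δ :=
        add_le_add (add_le_add (abs_div_sq_add_sq_le _ hδ) (abs_div_sq_add_sq_le _ hδ))
          (integral_abs_deriv_eval_div_le q hδ hab)
    _ = (3 * q.natDegree + 2) / δ := by field_simp; ring
    _ ≤ 5 := by
        rw [div_le_iff₀ hδ]
        linarith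

theorem natDegree_le_two_mul_abs_coeff_X_mul_derivative {P : ℝ[X]} {j : ℕ} (hj : 0 < j)
    (hdeg : P.natDegree ≤ 2 * j) (hc : 1 ≤ |P.coeff j|) :
    (P.natDegree : ℝ) ≤ 2 * |(X * derivative P).coeff j| := by
  have hcoeff : (X * derivative P).coeff j = P.coeff j * j := by
    obtain ⟨k, rfl⟩ := Nat.exists_eq_succ_of_ne_zero hj.ne'
    rw [coeff_X_mul, coeff_derivative, Nat.cast_succ]
  have hdeg' : (P.natDegree : ℝ) ≤ 2 * j := by exact_mod_cast hdeg
  rw [hcoeff, abs_mul, Nat.abs_cast]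
  nlinarith [(Nat.cast_nonneg j : (0 : ℝ) ≤ j)]

-- Integrating `(1 / q) P' e^{iP}`, `q = t P'`, by parts fails at the zeros of `q`, so `1 / q` is
-- replaced by `q / (q² + δ²)`; the second term is the error.
theorem expI_eval_div_eq (P : ℝ[X]) {δ t : ℝ} (hδ : 0 < δ) (ht : t ≠ 0) :
    expI (P.eval t) / (t : ℂ) =
      (((X * derivative P).eval t / ((X * derivative P).eval t ^ 2 + δ ^ 2) *
        (derivative P).eval t : ℝ) : ℂ) * expI (P.eval t) +
      ((δ ^ 2 / ((X * derivative P).eval t ^ 2 + δ ^ 2) / t : ℝ) : ℂ) * expI (P.eval t) := by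
  have hsum : (X * derivative P).eval t / ((X * derivative P).eval t ^ 2 + δ ^ 2) *
      (derivative P).eval t + δ ^ 2 / ((X * derivative P).eval t ^ 2 + δ ^ 2) / t = 1 / t := by
    have hden : (X * derivative P).eval t ^ 2 + δ ^ 2 ≠ 0 := by positivity
    field_simp
    rw [eval_mul, eval_X]
    ring
  rw [← add_mul, ← Complex.ofReal_add, hsum]
  push_cast
  ring

theorem norm_integral_expI_eval_div_le {P : ℝ[X]} {j : ℕ} (hj : 0 < j)
    (hdeg : P.natDegree ≤ 2 * j) (hc : 1 ≤ |P.coeff j|) {a b : ℝ} (ha : 1 ≤ a) (hab : a ≤ b) :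
    ‖∫ t in a..b, expI (P.eval t) / (t : ℂ)‖ ≤ 77 := by
  have hjP : j ≤ P.natDegree :=
    le_natDegree_of_ne_zero (abs_pos.1 (zero_lt_one.trans_le hc))
  set δ := (P.natDegree : ℝ)
  have hδ : 0 < δ := Nat.cast_pos.2 (hj.trans_le hjP)
  set q : ℝ[X] := X * derivative P
  have hqdeg : q.natDegree ≤ P.natDegree := by
    refine natDegree_mul_le.trans ?_
    rw [natDegree_X]
    have := natDegree_derivative_le P
    omega
  have hδq : δ ≤ 2 * |q.coeff j| := natDegree_le_two_mul_abs_coeff_X_mul_derivative hj hdeg hc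
  have hne : ∀ t ∈ Set.Icc a b, t ≠ 0 := fun t ht => (zero_lt_one.trans_le (ha.trans ht.1)).ne'
  have hden : ∀ t, q.eval t ^ 2 + δ ^ 2 ≠ 0 := fun t => by positivity
  have hcont : ContinuousOn (fun t => δ ^ 2 / (q.eval t ^ 2 + δ ^ 2) / t) (Set.Icc a b) := by
    fun_prop (disch := simp_all)
  have hsecond : ‖∫ t in a..b, ((δ ^ 2 / (q.eval t ^ 2 + δ ^ 2) / t : ℝ) : ℂ) *
      expI (P.eval t)‖ ≤ 72 := by
    refine (norm_integral_mul_expI_le _ _ hab).trans ?_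
    rw [intervalIntegral.integral_congr_Ioo_of_le hab fun t ht => abs_of_nonneg ?_]
    · exact integral_sq_div_eval_sq_add_sq_le (hqdeg.trans hdeg) hj hδ hδq ha hab
    · have ht0 : 0 < t := zero_lt_one.trans (ha.trans_lt ht.1)
      positivity
  have hsplit : Set.EqOn (fun t : ℝ => expI (P.eval t) / (t : ℂ)) _ (Set.uIcc a b) :=
    fun t ht => expI_eval_div_eq P hδ (hne t (by rwa [Set.uIcc_of_le hab] at ht))
  rw [intervalIntegral.integral_congr hsplit, intervalIntegral.integral_add]
  · refine (norm_add_le _ _).trans ?_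
    linarith [norm_integral_eval_div_mul_deriv_mul_expI_le (hj.trans_le hjP) hqdeg hab]
  · refine Continuous.intervalIntegrable ?_ _ _
    fun_prop (disch := simp_all)
  · refine ContinuousOn.intervalIntegrable_of_Icc hab ?_
    fun_prop

/-- The oscillatory integral `∫_{a ≤ |t| ≤ b} e^{iφ(t)} dt/t`, folded onto `[a, b]` so that the two
halves cancel where `φ` is small. -/
def oscIntegral (φ : ℝ → ℝ) (a b : ℝ) : ℂ := ∫ t in a..b, (expI (φ t) - expI (φ (-t))) / (t : ℂ)

theorem intervalIntegrable_oscIntegral {φ : ℝ → ℝ} {a b : ℝ}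
    (hφ : ContinuousOn φ (Set.Icc (-b) b)) (ha : 0 < a) (hab : a ≤ b) :
    IntervalIntegrable (fun t : ℝ => (expI (φ t) - expI (φ (-t))) / (t : ℂ)) volume a b := by
  refine ContinuousOn.intervalIntegrable_of_Icc hab ?_
  have hpos : ContinuousOn φ (Set.Icc a b) := hφ.mono fun t ht => ⟨by linarith [ht.1], ht.2⟩
  have hneg : ContinuousOn (fun t => φ (-t)) (Set.Icc a b) :=
    hφ.comp continuous_neg.continuousOn fun t ht => ⟨by linarith [ht.2], by linarith [ht.1]⟩
  exact ((continuous_expI.comp_continuousOn hpos).sub (continuous_expI.comp_continuousOn hneg)).div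
    Complex.continuous_ofReal.continuousOn
    fun t ht => Complex.ofReal_ne_zero.2 (ha.trans_le ht.1).ne'

theorem oscIntegral_add_adjacent {φ : ℝ → ℝ} {a b c : ℝ} (hφ : ContinuousOn φ (Set.Icc (-c) c))
    (ha : 0 < a) (hab : a ≤ b) (hbc : b ≤ c) :
    oscIntegral φ a b + oscIntegral φ b c = oscIntegral φ a c :=
  intervalIntegral.integral_add_adjacent_intervals
    (intervalIntegrable_oscIntegral
      (hφ.mono (Set.Icc_subset_Icc (neg_le_neg hbc) hbc)) ha hab)
    (intervalIntegrable_oscIntegral hφ (ha.trans_le hab) hbc)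

theorem oscIntegral_const (c a b : ℝ) : oscIntegral (fun _ => c) a b = 0 := by
  simp [oscIntegral]

theorem oscIntegral_comp_mul_left (φ : ℝ → ℝ) {ρ : ℝ} (hρ : 0 < ρ) (a b : ℝ) :
    oscIntegral (fun t => φ (ρ * t)) (a / ρ) (b / ρ) = oscIntegral φ a b := by
  have hsubst := intervalIntegral.integral_comp_mul_left (a := a / ρ) (b := b / ρ)
    (fun t : ℝ => (expI (φ t) - expI (φ (-t))) / (t : ℂ)) hρ.ne'
  rw [mul_div_cancel₀ _ hρ.ne', mul_div_cancel₀ _ hρ.ne', eq_inv_smul_iff₀ hρ.ne',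
    ← intervalIntegral.integral_smul] at hsubst
  rw [oscIntegral, oscIntegral, ← hsubst]
  refine intervalIntegral.integral_congr fun t _ => ?_
  have hρ' : (ρ : ℂ) ≠ 0 := Complex.ofReal_ne_zero.2 hρ.ne'
  simp only [Complex.real_smul, mul_neg, Complex.ofReal_mul]
  field_simp

theorem norm_oscIntegral_sub_le {φ χ g : ℝ → ℝ} {a b : ℝ} (hφ : ContinuousOn φ (Set.Icc (-b) b))
    (hχ : ContinuousOn χ (Set.Icc (-b) b)) (ha : 0 < a) (hab : a ≤ b)
    (hg : ∀ t, |t| ≤ b → |φ t - χ t| ≤ |t| * g |t|) (hgc : Continuous g) :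
    ‖oscIntegral φ a b - oscIntegral χ a b‖ ≤ 2 * ∫ t in a..b, g t := by
  rw [oscIntegral, oscIntegral, ← intervalIntegral.integral_sub
    (intervalIntegrable_oscIntegral hφ ha hab) (intervalIntegrable_oscIntegral hχ ha hab),
    ← intervalIntegral.integral_const_mul]
  refine intervalIntegral.norm_integral_le_of_norm_le hab (ae_of_all _ fun t ht => ?_)
    ((hgc.intervalIntegrable _ _).const_mul 2)
  have ht0 : 0 < t := ha.trans ht.1
  have hpos := (norm_expI_sub_expI_le _ _).trans (hg t (by rw [abs_of_pos ht0]; exact ht.2))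
  have hneg := (norm_expI_sub_expI_le _ _).trans
    (hg (-t) (by rw [abs_neg, abs_of_pos ht0]; exact ht.2))
  rw [abs_neg] at hneg
  rw [abs_of_pos ht0] at hpos hneg
  rw [← sub_div, norm_div, Complex.norm_real, Real.norm_of_nonneg ht0.le, div_le_iff₀ ht0,
    sub_sub_sub_comm]
  exact (norm_sub_le _ _).trans (by linarith)

theorem norm_oscIntegral_le_log (φ : ℝ → ℝ) {a b : ℝ} (ha : 0 < a) (hab : a ≤ b) :
    ‖oscIntegral φ a b‖ ≤ 2 * Real.log (b / a) := by
  rw [← integral_one_div_of_pos ha (ha.trans_le hab), ← intervalIntegral.integral_const_mul]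
  refine intervalIntegral.norm_integral_le_of_norm_le hab (ae_of_all _ fun t ht => ?_)
    (ContinuousOn.intervalIntegrable_of_Icc hab ?_)
  · have ht0 : 0 < t := ha.trans ht.1
    rw [norm_div, Complex.norm_real, Real.norm_of_nonneg ht0.le, mul_one_div]
    gcongr
    exact norm_expI_sub_expI_le_two _ _
  · have hne : ∀ t ∈ Set.Icc a b, t ≠ 0 := fun t ht => (ha.trans_le ht.1).ne'
    fun_prop (disch := simp_all)

theorem norm_oscIntegral_eval_le_of_one_le_abs_coeff {P : ℝ[X]} {j : ℕ} (hj : 0 < j)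
    (hdeg : P.natDegree ≤ 2 * j) (hc : 1 ≤ |P.coeff j|) {a b : ℝ} (ha : 1 ≤ a) (hab : a ≤ b) :
    ‖oscIntegral (fun t => P.eval t) a b‖ ≤ 154 := by
  have hint : ∀ Q : ℝ[X], IntervalIntegrable (fun t => expI (Q.eval t) / (t : ℂ)) volume a b :=
    fun Q => by
      refine ContinuousOn.intervalIntegrable_of_Icc hab ?_
      have hne : ∀ t ∈ Set.Icc a b, t ≠ 0 := fun t ht => (zero_lt_one.trans_le (ha.trans ht.1)).ne'
      fun_prop (disch := simp_all)
  have hsplit : oscIntegral (fun t => P.eval t) a b = (∫ t in a..b, expI (P.eval t) / (t : ℂ)) -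
      ∫ t in a..b, expI ((P.comp (C (-1) * X)).eval t) / (t : ℂ) := by
    rw [← intervalIntegral.integral_sub (hint P) (hint _)]
    simp [oscIntegral, sub_div, eval_comp]
  have hneg : ‖∫ t in a..b, expI ((P.comp (C (-1) * X)).eval t) / (t : ℂ)‖ ≤ 77 := by
    refine norm_integral_expI_eval_div_le hj ?_ ?_ ha hab
    · rwa [natDegree_comp, natDegree_C_mul_X _ (by norm_num), mul_one]
    · rwa [comp_C_mul_X_coeff, abs_mul, abs_pow, abs_neg, abs_one, one_pow, mul_one]
  rw [hsplit]
  exact (norm_sub_le _ _).trans (by linarith [norm_integral_expI_eval_div_le hj hdeg hc ha hab])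

theorem norm_oscIntegral_eval_le_of_scale_le {P : ℝ[X]} {j : ℕ} (hj : 0 < j)
    (hdeg : P.natDegree ≤ 2 * j) {ρ : ℝ} (hρ : 0 < ρ) (hc : 1 ≤ |P.coeff j| * ρ ^ j) {a b : ℝ}
    (ha : ρ ≤ a) (hab : a ≤ b) : ‖oscIntegral (fun t => P.eval t) a b‖ ≤ 154 := by
  have heval : ∀ t, P.eval (ρ * t) = (P.comp (C ρ * X)).eval t := fun t => by simp [eval_comp]
  rw [← oscIntegral_comp_mul_left _ hρ]
  simp only [heval]
  refine norm_oscIntegral_eval_le_of_one_le_abs_coeff hj ?_ ?_ (by rwa [one_le_div hρ])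
    (by gcongr)
  · rwa [natDegree_comp, natDegree_C_mul_X _ hρ.ne', mul_one]
  · rwa [comp_C_mul_X_coeff, abs_mul, abs_pow, abs_of_pos hρ]

theorem exists_scale {c : ℕ → ℝ} {H : Finset ℕ} (hH : ∀ j ∈ H, j ≠ 0) (hc : ∃ j ∈ H, c j ≠ 0) :
    ∃ ρ : ℝ, 0 < ρ ∧ (∃ j ∈ H, 1 ≤ |c j| * ρ ^ j) ∧ ∀ j ∈ H, |c j| * ρ ^ j ≤ 1 := by
  have hcrit : ∀ j ∈ H, c j ≠ 0 → |c j| * (|c j| ^ (-(j : ℝ)⁻¹)) ^ j = 1 := fun j hj hj0 => by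
    rw [Real.rpow_neg (abs_nonneg _), inv_pow, Real.rpow_inv_natCast_pow (abs_nonneg _) (hH j hj),
      mul_inv_cancel₀ (abs_ne_zero.2 hj0)]
  obtain ⟨j₀, hj₀, hmin⟩ := (H.filter (c · ≠ 0)).exists_min_image (fun j => |c j| ^ (-(j : ℝ)⁻¹))
    (by simpa [Finset.filter_nonempty_iff] using hc)
  rw [Finset.mem_filter] at hj₀
  refine ⟨|c j₀| ^ (-(j₀ : ℝ)⁻¹), Real.rpow_pos_of_pos (abs_pos.2 hj₀.2) _,
    ⟨j₀, hj₀.1, (hcrit j₀ hj₀.1 hj₀.2).ge⟩, fun j hj => ?_⟩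
  rcases eq_or_ne (c j) 0 with hj0 | hj0
  · simp [hj0]
  · refine le_trans ?_ (hcrit j hj hj0).le
    gcongr
    exact hmin j (Finset.mem_filter.2 ⟨hj, hj0⟩)

theorem natDegree_trunc_lt (P : ℝ[X]) {N : ℕ} (hN : 0 < N) :
    (PowerSeries.trunc N (P : PowerSeries ℝ)).natDegree < N := by
  obtain ⟨k, rfl⟩ := Nat.exists_eq_succ_of_ne_zero hN.ne'
  exact PowerSeries.natDegree_trunc_lt _ k

theorem eval_sub_eval_trunc {P : ℝ[X]} {N : ℕ} (hP : P.natDegree < 2 * N) (t : ℝ) :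
    P.eval t - (PowerSeries.trunc N (P : PowerSeries ℝ)).eval t =
      ∑ j ∈ Finset.Ico N (2 * N), P.coeff j * t ^ j := by
  rw [eval_eq_sum_range' hP, Finset.sum_Ico_eq_sub _ (by omega), eval,
    PowerSeries.eval₂_trunc_eq_sum_range]
  simp

theorem abs_eval_sub_eval_trunc_le {P : ℝ[X]} {N : ℕ} (hN : 0 < N) (hP : P.natDegree < 2 * N)
    {ρ : ℝ} (hρ : 0 < ρ) (hc : ∀ j ∈ Finset.Ico N (2 * N), |P.coeff j| * ρ ^ j ≤ 1) (t : ℝ) :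
    |P.eval t - (PowerSeries.trunc N (P : PowerSeries ℝ)).eval t| ≤
      |t| * ∑ j ∈ Finset.Ico N (2 * N), |t| ^ (j - 1) / ρ ^ j := by
  rw [eval_sub_eval_trunc hP, Finset.mul_sum]
  refine (Finset.abs_sum_le_sum_abs _ _).trans (Finset.sum_le_sum fun j hj => ?_)
  have hj0 : j ≠ 0 := (hN.trans_le (Finset.mem_Ico.1 hj).1).ne'
  rw [abs_mul, abs_pow, mul_div_assoc', mul_pow_sub_one hj0, le_div_iff₀ (by positivity)]
  calc |P.coeff j| * |t| ^ j * ρ ^ j = |P.coeff j| * ρ ^ j * |t| ^ j := by ring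
    _ ≤ |t| ^ j := mul_le_of_le_one_left (by positivity) (hc j hj)

theorem integral_sum_pow_div_pow_le_one {N : ℕ} (hN : 0 < N) {a b ρ : ℝ} (ha : 0 ≤ a)
    (hb : 0 ≤ b) (hρ : 0 < ρ) (hbρ : b ≤ ρ) :
    ∫ t in a..b, ∑ j ∈ Finset.Ico N (2 * N), t ^ (j - 1) / ρ ^ j ≤ 1 := by
  have hN' : (0 : ℝ) < N := Nat.cast_pos.2 hN
  have hterm : ∀ j ∈ Finset.Ico N (2 * N), ∫ t in a..b, t ^ (j - 1) / ρ ^ j ≤ 1 / N :=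
    fun j hj => by
      have hNj : N ≤ j := (Finset.mem_Ico.1 hj).1
      have hj : 0 < j := hN.trans_le hNj
      rw [intervalIntegral.integral_div, integral_pow, Nat.sub_add_cancel hj, Nat.cast_pred hj,
        sub_add_cancel, div_div, div_le_div_iff₀ (by positivity) hN', one_mul]
      calc (b ^ j - a ^ j) * N ≤ ρ ^ j * j := by
            gcongr
            exact (sub_le_self _ (by positivity)).trans (by gcongr)
        _ = j * ρ ^ j := mul_comm _ _
  rw [intervalIntegral.integral_finsetSum
    fun j _ => Continuous.intervalIntegrable (by fun_prop) _ _]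
  refine (Finset.sum_le_card_nsmul _ _ _ hterm).trans_eq ?_
  rw [Nat.card_Ico, two_mul, Nat.add_sub_cancel, nsmul_eq_mul, mul_one_div_cancel hN'.ne']

theorem norm_oscIntegral_eval_sub_trunc_le {P : ℝ[X]} {N : ℕ} (hN : 0 < N)
    (hP : P.natDegree < 2 * N) {ρ : ℝ} (hρ : 0 < ρ)
    (hc : ∀ j ∈ Finset.Ico N (2 * N), |P.coeff j| * ρ ^ j ≤ 1) {a b : ℝ} (ha : 0 < a) (hab : a ≤ b)
    (hb : b ≤ ρ) : ‖oscIntegral (fun t => P.eval t) a b -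
      oscIntegral (fun t => (PowerSeries.trunc N (P : PowerSeries ℝ)).eval t) a b‖ ≤ 2 := by
  refine (norm_oscIntegral_sub_le (by fun_prop) (by fun_prop) ha hab
    (g := fun t => ∑ j ∈ Finset.Ico N (2 * N), t ^ (j - 1) / ρ ^ j)
    (fun t _ => abs_eval_sub_eval_trunc_le hN hP hρ hc t) (by fun_prop)).trans ?_
  linarith [integral_sum_pow_div_pow_le_one hN ha.le (ha.le.trans hab) hρ hb]

theorem norm_oscIntegral_le_add_of_split {φ : ℝ → ℝ} (hφ : Continuous φ) {ρ A B : ℝ}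
    (hA : 0 ≤ A) (hB : 0 ≤ B)
    (hnear : ∀ a b, 0 < a → a ≤ b → b ≤ ρ → ‖oscIntegral φ a b‖ ≤ A)
    (hfar : ∀ a b, ρ ≤ a → a ≤ b → ‖oscIntegral φ a b‖ ≤ B) {a b : ℝ} (ha : 0 < a) (hab : a ≤ b) :
    ‖oscIntegral φ a b‖ ≤ A + B := by
  rcases le_total b ρ with hb | hb
  · linarith [hnear a b ha hab hb]
  rcases le_total a ρ with ha' | ha'
  · rw [← oscIntegral_add_adjacent hφ.continuousOn ha ha' hb]
    exact (norm_add_le _ _).trans (add_le_add (hnear a ρ ha ha' le_rfl) (hfar ρ b le_rfl hb))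
  · linarith [hfar a b ha' hab]

theorem norm_oscIntegral_eval_le {n : ℕ} {P : ℝ[X]} (hP : P.natDegree < 2 ^ n) {a b : ℝ}
    (ha : 0 < a) (hab : a ≤ b) : ‖oscIntegral (fun t => P.eval t) a b‖ ≤ 156 * n := by
  induction n generalizing P a b with
  | zero =>
    rw [pow_zero, Nat.lt_one_iff] at hP
    rw [eq_C_of_natDegree_eq_zero hP]
    simp only [eval_C, oscIntegral_const, norm_zero]
    positivity
  | succ n ih =>
    rw [pow_succ'] at hP
    have hN : 0 < 2 ^ n := by positivity
    push_cast
    by_cases hne : ∃ j ∈ Finset.Ico (2 ^ n) (2 * 2 ^ n), P.coeff j ≠ 0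
    · obtain ⟨ρ, hρ, ⟨j, hj, hlarge⟩, hsmall⟩ :=
        exists_scale (fun j hj => (hN.trans_le (Finset.mem_Ico.1 hj).1).ne') hne
      have hNj : 2 ^ n ≤ j := (Finset.mem_Ico.1 hj).1
      refine (norm_oscIntegral_le_add_of_split P.continuous (ρ := ρ) (A := 156 * n + 2) (B := 154)
        (by positivity) (by positivity) (fun a b ha hab hb => ?_) (fun a b ha hab => ?_)
        ha hab).trans_eq (by ring)
      · exact (norm_le_norm_add_norm_sub' _ _).trans (add_le_add
          (ih (natDegree_trunc_lt P hN) ha hab)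
          (norm_oscIntegral_eval_sub_trunc_le hN hP hρ hsmall ha hab hb))
      · exact norm_oscIntegral_eval_le_of_scale_le (hN.trans_le hNj) (by omega) hρ hlarge ha hab
    · push Not at hne
      have hP' : P.natDegree < 2 ^ n := by
        by_contra! hcon
        have hlead := hne P.natDegree (Finset.mem_Ico.2 ⟨hcon, hP⟩)
        rw [coeff_natDegree, leadingCoeff_eq_zero] at hlead
        rw [hlead, natDegree_zero] at hcon
        omega
      linarith [ih hP' ha hab]

/-! ### The upper bound -/

theorem truncated_eq_oscIntegral {r : ℝ} {ψ : ℝ → ℝ} (hψ : ContinuousOn ψ (Set.Icc (-r) r))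
    (lam : ℝ) {ε : ℝ} (hε : 0 < ε) (hεr : ε ≤ r) :
    truncated r ψ lam ε = oscIntegral (fun t => lam * ψ t) ε r := by
  have hint : ∀ s : ℝ, (∀ t ∈ Set.Icc ε r, s * t ∈ Set.Icc (-r) r) →
      IntervalIntegrable (fun t => expI (lam * ψ (s * t)) / (t : ℂ)) volume ε r := fun s hs => by
    have hc : ContinuousOn (fun t => lam * ψ (s * t)) (Set.Icc ε r) :=
      (hψ.comp (by fun_prop) hs).const_mul lam
    exact ContinuousOn.intervalIntegrable_of_Icc hεr
      ((continuous_expI.comp_continuousOn hc).div Complex.continuous_ofReal.continuousOn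
        fun t ht => Complex.ofReal_ne_zero.2 (hε.trans_le ht.1).ne')
  have hpos := hint 1 fun t ht => by constructor <;> linarith [ht.1, ht.2]
  have hneg := hint (-1) fun t ht => by constructor <;> linarith [ht.1, ht.2]
  simp only [one_mul, neg_one_mul] at hpos hneg
  simp only [oscIntegral, sub_div]
  rw [intervalIntegral.integral_sub hpos hneg, truncated, add_comm, sub_eq_add_neg,
    ← intervalIntegral.integral_neg, ← intervalIntegral.integral_comp_neg]
  simp [expI, div_neg]

theorem integrableOn_oscIntegral_of_lipschitzOnWith {r : ℝ} {φ : ℝ → ℝ} {C : NNReal}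
    (hφ : LipschitzOnWith C φ (Set.Icc (-r) r)) :
    IntegrableOn (fun t : ℝ => (expI (φ t) - expI (φ (-t))) / (t : ℂ)) (Set.Ioc 0 r) := by
  have hmem : ∀ t ∈ Set.Ioc 0 r, t ∈ Set.Icc (-r) r ∧ -t ∈ Set.Icc (-r) r := fun t ht =>
    ⟨⟨by linarith [ht.1, ht.2], ht.2⟩, by linarith [ht.2], by linarith [ht.1, ht.2]⟩
  have hpos : ContinuousOn φ (Set.Ioc 0 r) := hφ.continuousOn.mono fun t ht => (hmem t ht).1
  have hneg : ContinuousOn (fun t => φ (-t)) (Set.Ioc 0 r) :=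
    hφ.continuousOn.comp continuous_neg.continuousOn fun t ht => (hmem t ht).2
  have hcont := ((continuous_expI.comp_continuousOn hpos).sub
    (continuous_expI.comp_continuousOn hneg)).div Complex.continuous_ofReal.continuousOn
    fun t ht => Complex.ofReal_ne_zero.2 ht.1.ne'
  refine IntegrableOn.of_bound (by simp) (hcont.aestronglyMeasurable measurableSet_Ioc) (C * 2) ?_
  filter_upwards [ae_restrict_mem measurableSet_Ioc] with t ht
  rw [norm_div, Complex.norm_real, Real.norm_of_nonneg ht.1.le, div_le_iff₀ ht.1]
  refine (norm_expI_sub_expI_le _ _).trans ?_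
  have hlip := hφ.norm_sub_le (hmem t ht).1 (hmem t ht).2
  rwa [sub_neg_eq_add, ← two_mul, Real.norm_of_nonneg (by linarith [ht.1] : 0 ≤ 2 * t),
    ← mul_assoc] at hlip

theorem hasPV_of_lipschitzOnWith {r : ℝ} (hr : 0 < r) {ψ : ℝ → ℝ} {C : NNReal}
    (hψ : LipschitzOnWith C ψ (Set.Icc (-r) r)) (lam : ℝ) : HasPV r ψ lam (m r ψ lam) := by
  refine tendsto_nhds_limUnder ⟨oscIntegral (fun t => lam * ψ t) 0 r, ?_⟩
  have hint := integrableOn_oscIntegral_of_lipschitzOnWith (φ := fun t => lam * ψ t)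
    ((lipschitzWith_smul lam).comp_lipschitzOnWith hψ)
  rw [← integrableOn_Icc_iff_integrableOn_Ioc, ← Set.uIcc_of_le hr.le] at hint
  have hprim := intervalIntegral.continuousOn_primitive_interval_left hint 0 Set.left_mem_uIcc
  rw [Set.uIcc_of_le hr.le] at hprim
  refine (hprim.mono_left ?_).congr' ?_
  · rw [← nhdsWithin_Ioc_eq_nhdsGT hr]
    exact nhdsWithin_mono _ Set.Ioc_subset_Icc_self
  · filter_upwards [Ioc_mem_nhdsGT hr] with ε hε
    exact (truncated_eq_oscIntegral hψ.continuousOn lam hε.1 hε.2).symm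

theorem MemDenjoyCarleman.hasPV {M : ℕ → ℝ} {r : ℝ} {ψ : ℝ → ℝ} (hr : 0 < r)
    (h : MemDenjoyCarleman M r ψ) (lam : ℝ) : HasPV r ψ lam (m r ψ lam) := by
  obtain ⟨C, hC⟩ := h.1.exists_lipschitzOnWith (by simp) (convex_Icc _ _) isCompact_Icc
  exact hasPV_of_lipschitzOnWith hr hC lam

theorem HasPV.norm_sub_le {r lam : ℝ} {ψ : ℝ → ℝ} {z w : ℂ} {B δ : ℝ} (h : HasPV r ψ lam z)
    (hδ : 0 < δ) (hB : ∀ ε, 0 < ε → ε ≤ δ → ‖truncated r ψ lam ε - w‖ ≤ B) : ‖z - w‖ ≤ B := by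
  refine le_of_tendsto (h.sub_const w).norm ?_
  filter_upwards [Ioc_mem_nhdsGT hδ] with ε hε
  exact hB ε hε.1 hε.2

theorem iteratedDerivWithin_eq_of_subset {f : ℝ → ℝ} {n : ℕ} {s u : Set ℝ} (hsu : s ⊆ u)
    (hs : UniqueDiffOn ℝ s) (hu : UniqueDiffOn ℝ u) (hf : ContDiffOn ℝ n f u) {x : ℝ}
    (hx : x ∈ s) : iteratedDerivWithin n f s x = iteratedDerivWithin n f u x := by
  rw [iteratedDerivWithin, iteratedDerivWithin, iteratedFDerivWithin_subset hsu hs hu hf hx]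

theorem exists_polynomial_abs_sub_le {f : ℝ → ℝ} {s : Set ℝ} [s.OrdConnected]
    (hs : UniqueDiffOn ℝ s) (h₀ : 0 ∈ s) {n : ℕ} (hn : 0 < n) (hf : ContDiffOn ℝ n f s) {B : ℝ}
    (hB : ∀ t ∈ s, |iteratedDerivWithin n f s t| ≤ B) :
    ∃ P : ℝ[X], P.natDegree < n ∧ ∀ t ∈ s, |f t - P.eval t| ≤ B * |t| ^ n := by
  obtain ⟨k, rfl⟩ := Nat.exists_eq_succ_of_ne_zero hn.ne'
  refine ⟨∑ j ∈ Finset.range (k + 1), C ((j.factorial : ℝ)⁻¹ * iteratedDerivWithin j f s 0) * X ^ j,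
    Nat.lt_succ_of_le (natDegree_sum_le_of_forall_le _ _ fun j hj =>
      (natDegree_C_mul_X_pow_le _ _).trans (Nat.lt_succ_iff.1 (Finset.mem_range.1 hj))),
    fun t ht => ?_⟩
  have : 0 ≤ B := (abs_nonneg _).trans (hB t ht)
  rcases eq_or_ne 0 t with rfl | ht₀
  · rw [eval_finsetSum, Finset.sum_range_succ']
    simp
  have hsub : Set.uIcc 0 t ⊆ s := Set.OrdConnected.uIcc_subset ‹_› h₀ ht
  have huniq := uniqueDiffOn_uIcc ht₀
  have hmono : ∀ j ≤ k + 1, ∀ x ∈ Set.uIcc 0 t,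
      iteratedDerivWithin j f (Set.uIcc 0 t) x = iteratedDerivWithin j f s x := fun j hj x hx =>
    iteratedDerivWithin_eq_of_subset hsub huniq hs (hf.of_le (by exact_mod_cast hj)) hx
  obtain ⟨y, hy, htaylor⟩ := taylor_mean_remainder_lagrange ht₀
    ((hf.of_le (by norm_cast; omega)).mono hsub : ContDiffOn ℝ k f (Set.uIcc 0 t))
    (((hf.mono hsub).differentiableOn_iteratedDerivWithin (by norm_cast; omega) huniq).mono
      Set.uIoo_subset_uIcc_self)
  have hy' := Set.uIoo_subset_uIcc_self hy
  have heval : taylorWithinEval f k (Set.uIcc 0 t) 0 t = (∑ j ∈ Finset.range (k + 1),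
      C ((j.factorial : ℝ)⁻¹ * iteratedDerivWithin j f s 0) * X ^ j).eval t := by
    rw [taylor_within_apply, eval_finsetSum]
    refine Finset.sum_congr rfl fun j hj => ?_
    rw [hmono j (Finset.mem_range.1 hj).le 0 Set.left_mem_uIcc]
    simp only [sub_zero, smul_eq_mul, eval_mul, eval_C, eval_pow, eval_X]
    ring
  rw [← heval, htaylor, hmono _ le_rfl y hy', sub_zero, abs_div, abs_mul, abs_pow, Nat.abs_cast]
  exact (div_le_self (by positivity) (by exact_mod_cast (k + 1).factorial_pos)).trans
    (by gcongr; exact hB y (hsub hy'))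

theorem norm_oscIntegral_le_of_abs_iteratedDerivWithin_le {φ : ℝ → ℝ} {r δ : ℝ} {n : ℕ}
    (hn : 0 < n) (hφ : ContDiffOn ℝ n φ (Set.Icc (-r) r)) (hδr : δ ≤ r)
    (hB : ∀ t ∈ Set.Icc (-r) r, |iteratedDerivWithin n φ (Set.Icc (-r) r) t| ≤ (δ ^ n)⁻¹)
    {ε : ℝ} (hε : 0 < ε) (hεδ : ε ≤ δ) :
    ‖oscIntegral φ ε r‖ ≤ 2 + 156 * (Nat.log 2 n + 1) + 2 * Real.log (r / δ) := by
  have hδ : 0 < δ := hε.trans_le hεδ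
  have hr : 0 < r := hδ.trans_le hδr
  obtain ⟨P, hPn, hP⟩ := exists_polynomial_abs_sub_le (uniqueDiffOn_Icc (by linarith))
    ⟨by linarith, hr.le⟩ hn hφ hB
  have hnear : ‖oscIntegral φ ε δ - oscIntegral (fun t => P.eval t) ε δ‖ ≤ 2 := by
    refine (norm_oscIntegral_sub_le (g := fun t => (δ ^ n)⁻¹ * t ^ (n - 1))
      (hφ.continuousOn.mono (Set.Icc_subset_Icc (neg_le_neg hδr) hδr)) (by fun_prop) hε hεδ
      (fun t ht => (hP t (abs_le.1 (ht.trans hδr))).trans_eq ?_) (by fun_prop)).trans ?_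
    · rw [mul_left_comm, mul_pow_sub_one hn.ne']
    · rw [intervalIntegral.integral_const_mul, integral_pow, Nat.sub_add_cancel hn,
        Nat.cast_pred hn, sub_add_cancel]
      have hn₁ : (1 : ℝ) ≤ n := Nat.one_le_cast.2 hn
      have hle : (δ ^ n - ε ^ n) / n ≤ δ ^ n :=
        (div_le_self (sub_nonneg.2 (by gcongr)) hn₁).trans (sub_le_self _ (by positivity))
      calc 2 * ((δ ^ n)⁻¹ * ((δ ^ n - ε ^ n) / n)) ≤ 2 * ((δ ^ n)⁻¹ * δ ^ n) := by gcongr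
        _ = 2 := by rw [inv_mul_cancel₀ (by positivity), mul_one]
  have hpoly : ‖oscIntegral (fun t => P.eval t) ε δ‖ ≤ 156 * (Nat.log 2 n + 1) := by
    exact_mod_cast norm_oscIntegral_eval_le (hPn.trans (Nat.lt_pow_succ_log_self one_lt_two n))
      hε hεδ
  have hfar := norm_oscIntegral_le_log φ hδ hδr
  have htri := norm_le_norm_sub_add (oscIntegral φ ε δ) (oscIntegral (fun t => P.eval t) ε δ)
  rw [← oscIntegral_add_adjacent hφ.continuousOn hε hεδ hδr]
  exact (norm_add_le _ _).trans (by linarith)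

theorem norm_m_le_of_abs_iteratedDerivWithin_le {ψ : ℝ → ℝ} {r δ lam : ℝ} {n : ℕ} (hn : 0 < n)
    (hψ : ContDiffOn ℝ n ψ (Set.Icc (-r) r)) (hlam : 0 ≤ lam) (hδ : 0 < δ) (hδr : δ ≤ r)
    (hB : ∀ t ∈ Set.Icc (-r) r, lam * |iteratedDerivWithin n ψ (Set.Icc (-r) r) t| ≤ (δ ^ n)⁻¹)
    (hPV : HasPV r ψ lam (m r ψ lam)) :
    ‖m r ψ lam‖ ≤ 2 + 156 * (Nat.log 2 n + 1) + 2 * Real.log (r / δ) := by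
  rw [← sub_zero (m r ψ lam)]
  refine hPV.norm_sub_le hδ fun ε hε hεδ => ?_
  rw [sub_zero, truncated_eq_oscIntegral hψ.continuousOn lam hε (hεδ.trans hδr)]
  refine norm_oscIntegral_le_of_abs_iteratedDerivWithin_le hn (contDiffOn_const.mul hψ) hδr
    (fun t ht => ?_) hε hεδ
  rw [iteratedDerivWithin_const_mul ht (uniqueDiffOn_Icc (by linarith)) lam (hψ t ht), abs_mul,
    abs_of_nonneg hlam]
  exact hB t ht

theorem MemDenjoyCarleman.exists_norm_m_le {α c r : ℝ} (hc : 0 ≤ c) (hr : 0 < r) {ψ : ℝ → ℝ}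
    (h : MemDenjoyCarleman (weight c α) r ψ) :
    ∃ C, ∀ n : ℕ, 0 < n → ∀ lam : ℝ, 0 < lam → Real.log lam ≤ (n : ℝ) ^ α →
      ‖m r ψ lam‖ ≤ C + 156 * Nat.log 2 n + 2 * (1 + c) * (n : ℝ) ^ (α - 1) := by
  obtain ⟨hψ, K₀, hK₀, hbound⟩ := id h
  obtain ⟨L, hL₀, hLK, hLr⟩ : ∃ L : ℝ, 0 ≤ L ∧ K₀ ≤ Real.exp L ∧ Real.exp (-L) ≤ r := by
    refine ⟨max 0 (max (Real.log K₀) (-Real.log r)), le_max_left _ _, ?_, ?_⟩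
    · rw [← Real.log_le_iff_le_exp hK₀]
      exact (le_max_left _ _).trans (le_max_right _ _)
    · rw [← Real.le_log_iff_exp_le hr, neg_le]
      exact (le_max_right _ _).trans (le_max_right _ _)
  refine ⟨158 + 2 * Real.log r + 4 * L, fun n hn lam hlam hlog => ?_⟩
  have hn₀ : (0 : ℝ) < n := Nat.cast_pos.2 hn
  have hn₁ : (1 : ℝ) ≤ n := Nat.one_le_cast.2 hn
  set D : ℝ := (1 + c) * (n : ℝ) ^ (α - 1) + 2 * L with hD
  have hDn : n * D = (1 + c) * (n : ℝ) ^ α + 2 * n * L := by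
    rw [hD, Real.rpow_sub_one hn₀.ne']
    field_simp
  have hDL : L ≤ D := by
    have : 0 ≤ (1 + c) * (n : ℝ) ^ (α - 1) := by positivity
    linarith
  refine (norm_m_le_of_abs_iteratedDerivWithin_le hn (hψ.of_le (by exact_mod_cast le_top)) hlam.le
    (Real.exp_pos (-D)) ((Real.exp_le_exp.2 (neg_le_neg hDL)).trans hLr) (fun t ht => ?_)
    (h.hasPV hr lam)).trans_eq ?_
  · calc lam * |iteratedDerivWithin n ψ (Set.Icc (-r) r) t|
        ≤ Real.exp ((n : ℝ) ^ α) * (Real.exp L ^ (n + 1) * Real.exp (c * (n : ℝ) ^ α)) := by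
          gcongr
          · exact (Real.log_le_iff_le_exp hlam).1 hlog
          · exact (hbound n t ht).trans (by rw [weight]; gcongr)
      _ = Real.exp ((1 + c) * (n : ℝ) ^ α + (n + 1) * L) := by
          rw [← Real.exp_nat_mul, ← Real.exp_add, ← Real.exp_add]
          push_cast
          ring_nf
      _ ≤ Real.exp (n * D) := by
          rw [hDn]
          gcongr
          linarith
      _ = (Real.exp (-D) ^ n)⁻¹ := by rw [← Real.exp_nat_mul, ← Real.exp_neg]; ring_nf
  · rw [Real.log_div hr.ne' (Real.exp_pos _).ne', Real.log_exp, hD]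
    ring

theorem isBigO_natCast_rpow_bound {p : ℝ} (hp : 0 < p) (C B : ℝ) :
    (fun n : ℕ => C + 156 * Nat.log 2 n + B * (n : ℝ) ^ p) =O[atTop] fun n : ℕ => (n : ℝ) ^ p := by
  have hconst : (fun _ : ℕ => C) =O[atTop] fun n : ℕ => (n : ℝ) ^ p :=
    (isLittleO_const_left.2 (Or.inr (tendsto_norm_atTop_atTop.comp
      ((tendsto_rpow_atTop hp).comp tendsto_natCast_atTop_atTop)))).isBigO
  have hlog : (fun n : ℕ => (Nat.log 2 n : ℝ)) =O[atTop] fun n : ℕ => (n : ℝ) ^ p := by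
    refine (IsBigO.of_bound' (Eventually.of_forall fun n => ?_)).trans
      (((isLittleO_log_rpow_atTop hp).isBigO.comp_tendsto
        tendsto_natCast_atTop_atTop).const_mul_left (Real.log 2)⁻¹)
    rw [Real.norm_of_nonneg (Nat.cast_nonneg _), inv_mul_eq_div]
    exact (Real.natLog_le_logb n 2).trans (le_abs_self _)
  exact (hconst.add (hlog.const_mul_left 156)).add ((isBigO_refl _ _).const_mul_left B)

theorem isBigO_natCeil_rpow {p q : ℝ} (hp : 0 < p) (hq : 0 ≤ q) :
    (fun x : ℝ => (⌈x ^ p⌉₊ : ℝ) ^ q) =O[atTop] fun x : ℝ => x ^ (p * q) := by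
  have hceil : (fun x : ℝ => (⌈x ^ p⌉₊ : ℝ)) =O[atTop] fun x : ℝ => x ^ p :=
    isEquivalent_nat_ceil.isBigO.comp_tendsto (tendsto_rpow_atTop hp)
  refine (hceil.rpow hq ?_).congr' EventuallyEq.rfl ?_
  · filter_upwards [eventually_ge_atTop 0] with x hx using Real.rpow_nonneg hx p
  · filter_upwards [eventually_ge_atTop 0] with x hx using (Real.rpow_mul hx p q).symm

theorem MemDenjoyCarleman.isBigO_m {α c r : ℝ} (hα : 1 < α) (hc : 0 ≤ c) (hr : 0 < r)
    {ψ : ℝ → ℝ} (h : MemDenjoyCarleman (weight c α) r ψ) :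
    (fun lam : ℝ => m r ψ lam) =O[atTop] fun lam : ℝ => (Real.log lam) ^ (1 - 1 / α) := by
  have hα₀ : 0 < α := zero_lt_one.trans hα
  obtain ⟨C, hC⟩ := h.exists_norm_m_le hc hr
  have hdeg : Tendsto (fun lam => ⌈Real.log lam ^ (1 / α)⌉₊) atTop atTop :=
    tendsto_nat_ceil_atTop.comp
      ((tendsto_rpow_atTop (by positivity)).comp Real.tendsto_log_atTop)
  have hexp : 1 / α * (α - 1) = 1 - 1 / α := by field_simp
  refine (IsBigO.of_bound' ?_).trans
    (((isBigO_natCast_rpow_bound (sub_pos.2 hα) C (2 * (1 + c))).comp_tendsto hdeg).trans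
      (hexp ▸ (isBigO_natCeil_rpow (by positivity) (sub_pos.2 hα).le).comp_tendsto
        Real.tendsto_log_atTop))
  filter_upwards [eventually_gt_atTop 1, hdeg.eventually_gt_atTop 0] with lam hlam hpos
  refine (hC _ hpos lam (zero_lt_one.trans hlam) ?_).trans (le_abs_self _)
  have hlog := (Real.log_pos hlam).le
  calc Real.log lam = (Real.log lam ^ (1 / α)) ^ α := by
        rw [one_div, Real.rpow_inv_rpow hlog hα₀.ne']
    _ ≤ (⌈Real.log lam ^ (1 / α)⌉₊ : ℝ) ^ α := by
        gcongr
        exact Nat.le_ceil _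

/-! ### Flat phases -/

/-- The phase `exp(-A (b - log t)^β)` for `t > 0`, extended by `0`; it is only considered for
`t < e^b`, where the base of the power is positive. -/
def flatPhase (A β b t : ℝ) : ℝ :=
  if t ≤ 0 then 0 else Real.exp (-(A * (b - Real.log t) ^ β))

/-- The holomorphic continuation of `flatPhase` from the positive axis to `halfDisc b`. -/
def complexPhase (A β b : ℝ) (z : ℂ) : ℂ :=
  Complex.exp (-(A * (b - Complex.log z) ^ (β : ℂ)))

/-- The half disc `Re z > 0`, `|z| < e^b`, on which the principal branches in `complexPhase` are
holomorphic. -/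
def halfDisc (b : ℝ) : Set ℂ := {z | 0 < z.re ∧ ‖z‖ < Real.exp b}

theorem isOpen_halfDisc (b : ℝ) : IsOpen (halfDisc b) :=
  (isOpen_lt continuous_const Complex.continuous_re).inter
    (isOpen_lt continuous_norm continuous_const)

theorem ofReal_mem_halfDisc {b t : ℝ} (ht : 0 < t) (htb : t < Real.exp b) :
    (t : ℂ) ∈ halfDisc b :=
  ⟨by simpa using ht, by rwa [Complex.norm_real, Real.norm_of_nonneg ht.le]⟩

theorem differentiableOn_complexPhase (A β b : ℝ) :
    DifferentiableOn ℂ (complexPhase A β b) (halfDisc b) := fun z hz => by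
  have hz₀ : 0 < ‖z‖ := hz.1.trans_le ((le_abs_self _).trans (Complex.abs_re_le_norm z))
  have hlog : DifferentiableAt ℂ (fun z => (b : ℂ) - Complex.log z) z :=
    (differentiableAt_const _).sub (Complex.differentiableAt_log (Or.inl hz.1))
  have hslit : (b : ℂ) - Complex.log z ∈ Complex.slitPlane := by
    left
    rw [Complex.sub_re, Complex.ofReal_re, Complex.log_re, sub_pos, Real.log_lt_iff_lt_exp hz₀]
    exact hz.2
  exact ((hlog.cpow_const hslit).const_mul _).neg.cexp.differentiableWithinAt

theorem complexPhase_ofReal {A β b t : ℝ} (ht : 0 < t) (htb : t < Real.exp b) :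
    complexPhase A β b t = flatPhase A β b t := by
  have hb : 0 ≤ b - Real.log t := sub_nonneg.2 ((Real.log_lt_iff_lt_exp ht).2 htb).le
  rw [flatPhase, if_neg ht.not_ge, complexPhase, ← Complex.ofReal_log ht.le,
    ← Complex.ofReal_sub, ← Complex.ofReal_cpow hb]
  push_cast
  rfl

theorem half_le_re_one_add_cpow {β : ℝ} (hβ : 1 ≤ β) {w : ℂ} (hw : ‖w‖ ≤ 1 / (6 * β)) :
    1 / 2 ≤ ((1 + w) ^ (β : ℂ)).re := by
  have hw₁ : ‖w‖ ≤ 1 / 6 := hw.trans (by gcongr; linarith)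
  have hne : 1 + w ≠ 0 := fun h => by
    rw [eq_neg_of_add_eq_zero_right h, norm_neg, norm_one] at hw₁
    norm_num at hw₁
  have harg : ‖Complex.log (1 + w) * β‖ ≤ 1 / 4 := by
    rw [norm_mul, Complex.norm_real, Real.norm_of_nonneg (by positivity)]
    calc ‖Complex.log (1 + w)‖ * β ≤ 3 / 2 * (1 / (6 * β)) * β := by
          gcongr
          exact (Complex.norm_log_one_add_half_le_self (hw₁.trans (by norm_num))).trans (by gcongr)
      _ = 1 / 4 := by field_simp; norm_num
  have hexp := (Complex.abs_re_le_norm _).trans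
    (Complex.norm_exp_sub_one_le (harg.trans (by norm_num)))
  rw [Complex.cpow_def_of_ne_zero hne]
  rw [Complex.sub_re, Complex.one_re, abs_le] at hexp
  linarith

theorem rpow_div_two_le_re_cpow {β : ℝ} (hβ : 1 ≤ β) {l : ℝ} (hl : 0 < l) {η : ℂ}
    (hη : ‖η‖ ≤ l / (6 * β)) : l ^ β / 2 ≤ ((l + η) ^ (β : ℂ)).re := by
  have hw : ‖η / l‖ ≤ 1 / (6 * β) := by
    rw [norm_div, Complex.norm_real, Real.norm_of_nonneg hl.le, div_le_iff₀ hl, one_div_mul_eq_div]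
    exact hη
  have hfactor : (l : ℂ) + η = l * (1 + η / l) := by
    have : (l : ℂ) ≠ 0 := Complex.ofReal_ne_zero.2 hl.ne'
    field_simp
  have hre := half_le_re_one_add_cpow hβ hw
  have hpow : (l * (1 + η / l) : ℂ) ^ (β : ℂ) = (l ^ β : ℝ) * (1 + η / l) ^ (β : ℂ) := by
    have hne : 1 + η / l ≠ 0 := fun h => by
      rw [eq_neg_of_add_eq_zero_right h, norm_neg, norm_one, le_div_iff₀ (by positivity)] at hw
      linarith
    rw [Complex.ofReal_cpow hl.le, Complex.cpow_def_of_ne_zero hne,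
      Complex.cpow_def_of_ne_zero (mul_ne_zero (Complex.ofReal_ne_zero.2 hl.ne') hne),
      Complex.cpow_def_of_ne_zero (Complex.ofReal_ne_zero.2 hl.ne'),
      Complex.log_ofReal_mul hl hne, ← Complex.exp_add, ← add_mul, Complex.ofReal_log hl.le]
  rw [hfactor, hpow, Complex.re_ofReal_mul, div_eq_mul_one_div]
  gcongr

theorem norm_complexPhase_le {A β b t : ℝ} (hA : 0 ≤ A) (hβ : 1 ≤ β) (ht : 0 < t)
    (htb : t ≤ Real.exp (b - 1)) {z : ℂ} (hz : ‖z - t‖ ≤ t / (9 * β)) :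
    ‖complexPhase A β b z‖ ≤ Real.exp (-(A / 2 * (b - Real.log t) ^ β)) := by
  have hl : 1 ≤ b - Real.log t := by linarith [(Real.log_le_iff_le_exp ht).2 htb]
  have htC : (t : ℂ) ≠ 0 := Complex.ofReal_ne_zero.2 ht.ne'
  obtain ⟨ζ, rfl⟩ : ∃ ζ : ℂ, z = t * (1 + ζ) := ⟨z / t - 1, by field_simp; ring⟩
  have hζ : ‖ζ‖ ≤ 1 / (9 * β) := by
    rw [mul_add, mul_one, add_sub_cancel_left, norm_mul, Complex.norm_real,
      Real.norm_of_nonneg ht.le, mul_comm, ← le_div_iff₀ ht] at hz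
    exact hz.trans_eq (by field_simp)
  have hζ₁ : ‖ζ‖ ≤ 1 / 9 := hζ.trans (by gcongr; linarith)
  have hne : 1 + ζ ≠ 0 := fun h => by
    rw [eq_neg_of_add_eq_zero_right h, norm_neg, norm_one] at hζ₁
    norm_num at hζ₁
  have hη : ‖-Complex.log (1 + ζ)‖ ≤ (b - Real.log t) / (6 * β) := by
    rw [norm_neg]
    calc ‖Complex.log (1 + ζ)‖ ≤ 3 / 2 * (1 / (9 * β)) :=
          (Complex.norm_log_one_add_half_le_self (hζ₁.trans (by norm_num))).trans (by gcongr)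
      _ = 1 / (6 * β) := by field_simp; norm_num
      _ ≤ (b - Real.log t) / (6 * β) := by gcongr
  have hre := rpow_div_two_le_re_cpow hβ (zero_lt_one.trans_le hl) hη
  have hlog : (b : ℂ) - Complex.log (t * (1 + ζ)) =
      ((b - Real.log t : ℝ) : ℂ) + -Complex.log (1 + ζ) := by
    rw [Complex.log_ofReal_mul ht hne]
    push_cast
    ring
  rw [complexPhase, Complex.norm_exp, hlog, Complex.neg_re, Complex.re_ofReal_mul, div_mul_comm,
    mul_comm]
  gcongr

theorem closedBall_subset_halfDisc {b t ρ : ℝ} (htb : t ≤ Real.exp (b - 1))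
    (hρ : ρ < t) : Metric.closedBall (t : ℂ) ρ ⊆ halfDisc b := fun z hz => by
  rw [mem_closedBall_iff_norm] at hz
  have hρ₀ : 0 ≤ ρ := (norm_nonneg _).trans hz
  constructor
  · have hre := (Complex.abs_re_le_norm (z - t)).trans hz
    rw [Complex.sub_re, Complex.ofReal_re, abs_le] at hre
    linarith
  · have hnorm := norm_le_norm_add_norm_sub' z (t : ℂ)
    rw [Complex.norm_real, Real.norm_of_nonneg (by linarith)] at hnorm
    have hexp : Real.exp b = Real.exp (b - 1) * Real.exp 1 := by rw [← Real.exp_add]; ring_nf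
    nlinarith [Real.exp_one_gt_d9, Real.exp_pos (b - 1)]

theorem norm_iteratedDeriv_complexPhase_le {A β b t : ℝ} (hA : 0 ≤ A) (hβ : 1 ≤ β) (ht : 0 < t)
    (htb : t ≤ Real.exp (b - 1)) (n : ℕ) :
    ‖iteratedDeriv n (complexPhase A β b) t‖ ≤
      n.factorial * Real.exp (-(A / 2 * (b - Real.log t) ^ β)) / (t / (9 * β)) ^ n :=
  Complex.norm_iteratedDeriv_le_of_forall_mem_sphere_norm_le n (by positivity)
    ((differentiableOn_complexPhase A β b).diffContOnCl_ball
      (closedBall_subset_halfDisc htb (div_lt_self ht (by linarith))))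
    fun _ hz => norm_complexPhase_le hA hβ ht htb (mem_sphere_iff_norm.1 hz).le

theorem young_inequality_scaled {α β A k l : ℝ} (hαβ : α.HolderConjugate β) (hA : 0 < A)
    (hk : 0 ≤ k) (hl : 0 ≤ l) : k * l ≤ (β * A) ^ (1 - α) / α * k ^ α + A * l ^ β := by
  have hβ : 0 < β := hαβ.symm.pos
  set τ : ℝ := (β * A) ^ β⁻¹ with hτ
  have hτ₀ : 0 < τ := by positivity
  have hτβ : τ ^ β = β * A := Real.rpow_inv_rpow (by positivity) hβ.ne'
  have hτα : τ ^ α = ((β * A) ^ (1 - α))⁻¹ := by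
    rw [hτ, ← Real.rpow_mul (by positivity), ← Real.rpow_neg (by positivity), inv_mul_eq_div,
      hαβ.div_conj_eq_sub_one, neg_sub]
  have hyoung := Real.young_inequality_of_nonneg (a := k / τ) (b := τ * l) (by positivity)
    (by positivity) hαβ
  rw [Real.div_rpow hk hτ₀.le, Real.mul_rpow hτ₀.le hl, hτβ, hτα, div_mul_eq_mul_div,
    mul_left_comm, mul_div_cancel_left₀ _ hτ₀.ne'] at hyoung
  refine hyoung.trans_eq ?_
  field_simp

theorem exp_neg_rpow_le_mul_pow {α β A b t : ℝ} (hαβ : α.HolderConjugate β) (hA : 0 < A)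
    (ht : 0 < t) (htb : t ≤ Real.exp b) (k : ℕ) :
    Real.exp (-(A * (b - Real.log t) ^ β)) ≤
      Real.exp ((β * A) ^ (1 - α) / α * (k : ℝ) ^ α - k * b) * t ^ k := by
  have hpow : t ^ k = Real.exp (k * Real.log t) := by rw [Real.exp_nat_mul, Real.exp_log ht]
  have hyoung := young_inequality_scaled hαβ hA k.cast_nonneg
    (sub_nonneg.2 ((Real.log_le_iff_le_exp ht).2 htb))
  rw [hpow, ← Real.exp_add, Real.exp_le_exp]
  linarith

/-- The candidate for the `n`-th derivative of `flatPhase`. -/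
def flatPhaseDeriv (A β b : ℝ) (n : ℕ) (t : ℝ) : ℝ :=
  if t ≤ 0 then 0 else (iteratedDeriv n (complexPhase A β b) t).re

theorem flatPhaseDeriv_zero {A β b t : ℝ} (htb : t < Real.exp b) :
    flatPhaseDeriv A β b 0 t = flatPhase A β b t := by
  rcases le_or_gt t 0 with ht | ht
  · rw [flatPhase, flatPhaseDeriv, if_pos ht, if_pos ht]
  · rw [flatPhaseDeriv, if_neg ht.not_ge, iteratedDeriv_zero, complexPhase_ofReal ht htb,
      Complex.ofReal_re]

theorem abs_flatPhaseDeriv_le {α β A b t : ℝ} (hαβ : α.HolderConjugate β) (hA : 0 < A)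
    (htb : t ≤ Real.exp (b - 1)) (n k : ℕ) :
    |flatPhaseDeriv A β b n t| ≤ n.factorial * (9 * β) ^ n *
      Real.exp ((β * (A / 2)) ^ (1 - α) / α * ((n + k : ℕ) : ℝ) ^ α - (n + k : ℕ) * b) *
        |t| ^ k := by
  have hβ : 0 < β := hαβ.symm.pos
  rcases le_or_gt t 0 with ht | ht
  · rw [flatPhaseDeriv, if_pos ht, abs_zero]
    positivity
  · rw [flatPhaseDeriv, if_neg ht.not_ge, abs_of_pos ht]
    calc |(iteratedDeriv n (complexPhase A β b) t).re|
        ≤ n.factorial * Real.exp (-(A / 2 * (b - Real.log t) ^ β)) / (t / (9 * β)) ^ n :=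
          (Complex.abs_re_le_norm _).trans
            (norm_iteratedDeriv_complexPhase_le hA.le hαβ.symm.lt.le ht htb n)
      _ ≤ n.factorial * (Real.exp ((β * (A / 2)) ^ (1 - α) / α * ((n + k : ℕ) : ℝ) ^ α -
            (n + k : ℕ) * b) * t ^ (n + k)) / (t / (9 * β)) ^ n := by
          gcongr
          exact exp_neg_rpow_le_mul_pow hαβ (half_pos hA) ht
            (htb.trans (Real.exp_le_exp.2 (by linarith))) (n + k)
      _ = _ := by
          rw [div_pow, pow_add]
          field_simp

theorem hasDerivAt_flatPhaseDeriv_zero {α β A b : ℝ} (hαβ : α.HolderConjugate β) (hA : 0 < A)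
    (n : ℕ) : HasDerivAt (flatPhaseDeriv A β b n) 0 0 := by
  have hquad : flatPhaseDeriv A β b n =O[𝓝 0] fun t => ‖t - 0‖ ^ 2 := by
    refine IsBigO.of_bound (n.factorial * (9 * β) ^ n *
      Real.exp ((β * (A / 2)) ^ (1 - α) / α * ((n + 2 : ℕ) : ℝ) ^ α - (n + 2 : ℕ) * b)) ?_
    filter_upwards [Iio_mem_nhds (Real.exp_pos (b - 1))] with t ht
    rw [sub_zero, norm_pow, norm_norm]
    exact abs_flatPhaseDeriv_le hαβ hA (le_of_lt ht) n 2
  simpa using (hquad.hasFDerivAt one_lt_two).hasDerivAt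

theorem hasDerivAt_flatPhaseDeriv {α β A b : ℝ} (hαβ : α.HolderConjugate β) (hA : 0 < A) (n : ℕ)
    {t : ℝ} (htb : t < Real.exp b) :
    HasDerivAt (flatPhaseDeriv A β b n) (flatPhaseDeriv A β b (n + 1) t) t := by
  rcases lt_trichotomy t 0 with ht | rfl | ht
  · rw [flatPhaseDeriv, if_pos ht.le]
    refine (hasDerivAt_const t (0 : ℝ)).congr_of_eventuallyEq ?_
    filter_upwards [Iio_mem_nhds ht] with s hs using if_pos (le_of_lt hs)
  · rw [flatPhaseDeriv, if_pos le_rfl]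
    exact hasDerivAt_flatPhaseDeriv_zero hαβ hA n
  · have hderiv : HasDerivAt (iteratedDeriv n (complexPhase A β b))
        (iteratedDeriv (n + 1) (complexPhase A β b) t) (t : ℂ) := by
      rw [iteratedDeriv_succ, hasDerivAt_deriv_iff, iteratedDeriv_eq_iterate]
      exact (((differentiableOn_complexPhase A β b).analyticOnNhd
        (isOpen_halfDisc b)).iterated_deriv n t (ofReal_mem_halfDisc ht htb)).differentiableAt
    rw [flatPhaseDeriv, if_neg ht.not_ge]
    refine hderiv.real_of_complex.congr_of_eventuallyEq ?_
    filter_upwards [Ioi_mem_nhds ht] with s hs using if_neg (not_le.2 hs)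

theorem iteratedDerivWithin_eq_of_hasDerivWithinAt_succ {𝕜 F : Type*} [NontriviallyNormedField 𝕜]
    [NormedAddCommGroup F] [NormedSpace 𝕜 F] {s : Set 𝕜} (hs : UniqueDiffOn 𝕜 s)
    {g : ℕ → 𝕜 → F} (hg : ∀ n, ∀ x ∈ s, HasDerivWithinAt (g n) (g (n + 1) x) s x) (n : ℕ) :
    Set.EqOn (iteratedDerivWithin n (g 0) s) (g n) s := by
  induction n with
  | zero => exact fun x _ => congrFun iteratedDerivWithin_zero x
  | succ n ih =>
    intro x hx
    rw [iteratedDerivWithin_succ, derivWithin_congr ih (ih hx), (hg n x hx).derivWithin (hs x hx)]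

theorem contDiffOn_of_hasDerivWithinAt_succ {𝕜 F : Type*} [NontriviallyNormedField 𝕜]
    [NormedAddCommGroup F] [NormedSpace 𝕜 F] {s : Set 𝕜} (hs : UniqueDiffOn 𝕜 s)
    {g : ℕ → 𝕜 → F} (hg : ∀ n, ∀ x ∈ s, HasDerivWithinAt (g n) (g (n + 1) x) s x) :
    ContDiffOn 𝕜 ∞ (g 0) s :=
  contDiffOn_of_differentiableOn_deriv fun n _ => DifferentiableOn.congr
    (fun x hx => (hg n x hx).differentiableWithinAt)
    (iteratedDerivWithin_eq_of_hasDerivWithinAt_succ hs hg n)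

theorem log_le_mul_rpow_sub {c p x : ℝ} (hc : 0 < c) (hp : 0 < p) (hx : 0 < x) :
    Real.log x ≤ c * x ^ p - (1 + Real.log (c * p)) / p := by
  have hlog := Real.log_le_sub_one_of_pos (by positivity : 0 < c * p * x ^ p)
  rw [Real.log_mul (by positivity) (by positivity), Real.log_rpow hx] at hlog
  rw [le_sub_iff_add_le, ← le_sub_iff_add_le', div_le_iff₀ hp]
  linarith

theorem exists_factorial_le {α c : ℝ} (hα : 1 < α) (hc : 0 < c) :
    ∃ C : ℝ, 0 < C ∧ ∀ n : ℕ, (n.factorial : ℝ) ≤ C ^ n * Real.exp (c * (n : ℝ) ^ α) := by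
  set L : ℝ := (1 + Real.log (c * (α - 1))) / (α - 1)
  refine ⟨Real.exp (-L), Real.exp_pos _, fun n => ?_⟩
  rcases Nat.eq_zero_or_pos n with rfl | hn
  · simp [Real.zero_rpow (zero_lt_one.trans hα).ne']
  have hn₀ : (0 : ℝ) < n := Nat.cast_pos.2 hn
  calc (n.factorial : ℝ) ≤ (n : ℝ) ^ n := by exact_mod_cast Nat.factorial_le_pow n
    _ = Real.exp (n * Real.log n) := by rw [Real.exp_nat_mul, Real.exp_log hn₀]
    _ ≤ Real.exp (n * (c * (n : ℝ) ^ (α - 1) - L)) := by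
      gcongr
      exact log_le_mul_rpow_sub hc (sub_pos.2 hα) hn₀
    _ = Real.exp (-L) ^ n * Real.exp (c * (n : ℝ) ^ α) := by
      rw [← Real.exp_nat_mul, ← Real.exp_add, Real.rpow_sub_one hn₀.ne']
      field_simp
      ring_nf

theorem exists_abs_flatPhaseDeriv_le_pow_mul_weight {α β A c : ℝ} (hαβ : α.HolderConjugate β)
    (hA : 0 < A) (hc : (β * (A / 2)) ^ (1 - α) / α < c) (b : ℝ) :
    ∃ K : ℝ, 0 < K ∧ ∀ n, ∀ t ≤ Real.exp (b - 1),
      |flatPhaseDeriv A β b n t| ≤ K ^ n * weight c α n := by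
  have hβ : 0 < β := hαβ.symm.pos
  set c₀ := (β * (A / 2)) ^ (1 - α) / α
  obtain ⟨C, hC, hfact⟩ := exists_factorial_le hαβ.lt (sub_pos.2 hc)
  refine ⟨9 * β * C * Real.exp (-b), by positivity, fun n t ht => ?_⟩
  have hexp : Real.exp ((c - c₀) * (n : ℝ) ^ α) * Real.exp (c₀ * (n : ℝ) ^ α - n * b) =
      Real.exp (-b) ^ n * weight c α n := by
    rw [weight, ← Real.exp_nat_mul, ← Real.exp_add, ← Real.exp_add]
    ring_nf
  calc |flatPhaseDeriv A β b n t|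
      ≤ n.factorial * (9 * β) ^ n * Real.exp (c₀ * (n : ℝ) ^ α - n * b) := by
        simpa using abs_flatPhaseDeriv_le hαβ hA ht n 0
    _ ≤ C ^ n * Real.exp ((c - c₀) * (n : ℝ) ^ α) * (9 * β) ^ n *
        Real.exp (c₀ * (n : ℝ) ^ α - n * b) := by
        gcongr
        exact hfact n
    _ = (9 * β * C * Real.exp (-b)) ^ n * weight c α n := by
        rw [mul_pow _ (Real.exp _), mul_pow _ C]
        linear_combination C ^ n * (9 * β) ^ n * hexp

theorem memDenjoyCarleman_flatPhase {α β A b c : ℝ} (hαβ : α.HolderConjugate β) (hA : 0 < A)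
    (hc : (β * (A / 2)) ^ (1 - α) / α < c) :
    MemDenjoyCarleman (weight c α) (Real.exp (b - 1)) (flatPhase A β b) := by
  set I := Set.Icc (-Real.exp (b - 1)) (Real.exp (b - 1))
  have hI : UniqueDiffOn ℝ I := uniqueDiffOn_Icc (by linarith [Real.exp_pos (b - 1)])
  have hlt : ∀ t ∈ I, t < Real.exp b := fun t ht =>
    ht.2.trans_lt (Real.exp_lt_exp.2 (by linarith))
  have hderiv : ∀ n, ∀ t ∈ I,
      HasDerivWithinAt (flatPhaseDeriv A β b n) (flatPhaseDeriv A β b (n + 1) t) I t :=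
    fun n t ht => (hasDerivAt_flatPhaseDeriv hαβ hA n (hlt t ht)).hasDerivWithinAt
  have hzero : Set.EqOn (flatPhase A β b) (flatPhaseDeriv A β b 0) I := fun t ht =>
    (flatPhaseDeriv_zero (hlt t ht)).symm
  obtain ⟨K, hK, hbound⟩ := exists_abs_flatPhaseDeriv_le_pow_mul_weight hαβ hA hc b
  refine ⟨(contDiffOn_of_hasDerivWithinAt_succ hI hderiv).congr hzero, max 1 K, by positivity,
    fun n t ht => ?_⟩
  rw [iteratedDerivWithin_congr hzero ht,
    iteratedDerivWithin_eq_of_hasDerivWithinAt_succ hI hderiv n ht]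
  have hpow : K ^ n ≤ max 1 K ^ (n + 1) :=
    (pow_le_pow_left₀ hK.le (le_max_right _ _) n).trans
      (pow_le_pow_right₀ (le_max_left _ _) n.le_succ)
  exact (hbound n t ht.2).trans (mul_le_mul_of_nonneg_right hpow (Real.exp_pos _).le)

/-! ### Growth along a sequence -/

theorem oscIntegral_exp_sub (φ : ℝ → ℝ) (b u v : ℝ) :
    oscIntegral φ (Real.exp (b - v)) (Real.exp (b - u)) =
      ∫ s in u..v, (expI (φ (Real.exp (b - s))) - expI (φ (-Real.exp (b - s)))) := by
  have hderiv : ∀ s, HasDerivAt (fun s => Real.exp (b - s)) (-Real.exp (b - s)) s := fun s => by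
    simpa using ((hasDerivAt_id s).const_sub b).exp
  have hsubst := intervalIntegral.integral_deriv_smul_comp_of_deriv_nonpos
    (g := fun t : ℝ => (expI (φ t) - expI (φ (-t))) / (t : ℂ)) (a := u) (b := v)
    (f := fun s => Real.exp (b - s)) (f' := fun s => -Real.exp (b - s)) (by fun_prop)
    (fun s _ => hderiv s) (fun s _ => by simpa using (Real.exp_pos _).le)
  rw [oscIntegral, intervalIntegral.integral_symm, ← hsubst, ← intervalIntegral.integral_neg]
  refine intervalIntegral.integral_congr fun s _ => ?_
  have hne : (Real.exp (b - s) : ℂ) ≠ 0 := Complex.ofReal_ne_zero.2 (Real.exp_pos _).ne'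
  simp only [Function.comp_apply, neg_smul, neg_neg, Complex.real_smul]
  exact mul_div_cancel₀ _ hne

theorem norm_integral_expI_le_of_mul_deriv_eq_neg_one {f f' φ φ' : ℝ → ℝ} {a b : ℝ} (hab : a ≤ b)
    (hf : ∀ t ∈ Set.Icc a b, HasDerivAt f (f' t) t) (hf' : ContinuousOn f' (Set.Icc a b))
    (hφ : ∀ t ∈ Set.Icc a b, HasDerivAt φ (φ' t) t) (hφ' : ContinuousOn φ' (Set.Icc a b))
    (hfφ : ∀ t ∈ Set.Icc a b, f t * φ' t = -1) (hfa : 0 ≤ f a)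
    (hf'₀ : ∀ t ∈ Set.Icc a b, 0 ≤ f' t) : ‖∫ t in a..b, expI (φ t)‖ ≤ 2 * f b := by
  have hint : ∫ t in a..b, |f' t| = f b - f a := by
    rw [← Set.uIcc_of_le hab] at *
    rw [intervalIntegral.integral_congr fun t ht => abs_of_nonneg (hf'₀ t ht)]
    exact intervalIntegral.integral_eq_sub_of_hasDerivAt hf hf'.intervalIntegrable
  have hfb : f a ≤ f b := by
    rw [← sub_nonneg, ← hint]
    exact intervalIntegral.integral_nonneg hab fun t _ => abs_nonneg _
  have hparts := norm_integral_mul_deriv_mul_expI_le hab hf hf' hφ hφ'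
  rw [hint, abs_of_nonneg hfa, abs_of_nonneg (hfa.trans hfb)] at hparts
  have hcongr : ∫ t in a..b, ((f t * φ' t : ℝ) : ℂ) * expI (φ t) = -∫ t in a..b, expI (φ t) := by
    rw [← intervalIntegral.integral_neg]
    refine intervalIntegral.integral_congr fun t ht => ?_
    rw [Set.uIcc_of_le hab] at ht
    simp only [hfφ t ht, Complex.ofReal_neg, Complex.ofReal_one, neg_one_mul]
  rw [hcongr, norm_neg] at hparts
  linarith

theorem sub_le_mul_rpow_sub_rpow {A β U u : ℝ} (hA : 1 ≤ A) (hβ : 1 ≤ β) (hU : 1 ≤ U)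
    (hu : U ≤ u) : u - U ≤ A * (u ^ β - U ^ β) := by
  have hU₀ : 0 < U := zero_lt_one.trans_le hU
  have hu₀ : 0 < u := hU₀.trans_le hu
  have hUpow : U ^ β = U ^ (β - 1) * U := by rw [Real.rpow_sub_one hU₀.ne']; field_simp
  have hupow : u ^ β = u ^ (β - 1) * u := by rw [Real.rpow_sub_one hu₀.ne']; field_simp
  have hone : 1 ≤ U ^ (β - 1) := Real.one_le_rpow hU (by linarith)
  have hmono : U ^ (β - 1) ≤ u ^ (β - 1) := Real.rpow_le_rpow hU₀.le hu (by linarith)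
  have hsub : u - U ≤ u ^ β - U ^ β := by rw [hUpow, hupow]; nlinarith
  nlinarith

theorem norm_integral_expI_exp_sub_one_le {A β U E : ℝ} (hA : 1 ≤ A) (hβ : 1 ≤ β) (hU : 1 ≤ U)
    (hE : U ≤ E) : ‖∫ u in U..E, (expI (Real.exp (A * (U ^ β - u ^ β))) - 1)‖ ≤ 1 := by
  calc ‖∫ u in U..E, (expI (Real.exp (A * (U ^ β - u ^ β))) - 1)‖
      ≤ ∫ u in U..E, Real.exp (U - u) := by
        refine intervalIntegral.norm_integral_le_of_norm_le hE (ae_of_all _ fun u hu => ?_)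
          (Continuous.intervalIntegrable (by fun_prop) _ _)
        refine Real.norm_exp_I_mul_ofReal_sub_one_le.trans ?_
        rw [Real.norm_of_nonneg (Real.exp_pos _).le, Real.exp_le_exp]
        linarith [sub_le_mul_rpow_sub_rpow hA hβ hU hu.1.le]
    _ = 1 - Real.exp (U - E) := by
        rw [intervalIntegral.integral_comp_sub_left (fun x => Real.exp x), integral_exp, sub_self,
          Real.exp_zero]
    _ ≤ 1 := sub_le_self _ (Real.exp_pos _).le

theorem hasDerivAt_exp_rpow_mul_rpow {A β B u : ℝ} (hA : A ≠ 0) (hβ : β ≠ 0) (hu : 0 < u) :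
    HasDerivAt (fun u : ℝ => Real.exp (A * (u ^ β - B)) * u ^ (1 - β) / (A * β))
      (Real.exp (A * (u ^ β - B)) * (1 - (β - 1) / (A * β) * u ^ (-β))) u := by
  have hexp : HasDerivAt (fun u : ℝ => Real.exp (A * (u ^ β - B))) _ u :=
    (((Real.hasDerivAt_rpow_const (Or.inl hu.ne')).sub_const B).const_mul A).exp
  refine ((hexp.mul (Real.hasDerivAt_rpow_const (p := 1 - β)
    (Or.inl hu.ne'))).div_const (A * β)).congr_deriv ?_
  have hpow : u ^ β ≠ 0 := (Real.rpow_pos_of_pos hu β).ne'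
  rw [show 1 - β - 1 = -β by ring, Real.rpow_sub hu 1 β, Real.rpow_sub_one hu.ne',
    Real.rpow_neg hu.le, Real.rpow_one]
  field_simp
  ring

theorem norm_integral_expI_exp_le {A β U : ℝ} (hA : 1 ≤ A) (hβ : 1 ≤ β) (hU : 1 ≤ U) :
    ‖∫ u in (1)..U, expI (Real.exp (A * (U ^ β - u ^ β)))‖ ≤ 2 := by
  have hA₀ : 0 < A := zero_lt_one.trans_le hA
  have hβ₀ : 0 < β := zero_lt_one.trans_le hβ
  have hpos : ∀ u ∈ Set.Icc 1 U, 0 < u := fun u hu => zero_lt_one.trans_le hu.1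
  have hrpow : ∀ p : ℝ, ContinuousOn (fun u : ℝ => u ^ p) (Set.Icc 1 U) := fun p =>
    continuousOn_id.rpow_const fun u hu => Or.inl (hpos u hu).ne'
  have := hrpow β
  have := hrpow (β - 1)
  have hβ_neg := hrpow (-β)
  have hAβ : (β - 1) / (A * β) ≤ 1 := by
    rw [div_le_one (by positivity)]
    nlinarith
  refine (norm_integral_expI_le_of_mul_deriv_eq_neg_one hU
    (fun u hu => hasDerivAt_exp_rpow_mul_rpow (B := U ^ β) hA₀.ne' hβ₀.ne' (hpos u hu))
    (by fun_prop)
    (fun u hu => (((Real.hasDerivAt_rpow_const (Or.inl (hpos u hu).ne')).const_sub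
      (U ^ β)).const_mul A).exp) (by fun_prop) (fun u hu => ?_) (by positivity)
    fun u hu => mul_nonneg (Real.exp_pos _).le (sub_nonneg.2 ?_)).trans ?_
  · have hu₀ := hpos u hu
    rw [← neg_sub (u ^ β), mul_neg A, Real.exp_neg, Real.rpow_sub hu₀ 1 β,
      Real.rpow_sub_one hu₀.ne', Real.rpow_one]
    have hpow : u ^ β ≠ 0 := (Real.rpow_pos_of_pos hu₀ β).ne'
    field_simp
  · exact mul_le_one₀ hAβ (Real.rpow_nonneg (hpos u hu).le _)
      (Real.rpow_le_one_of_one_le_of_nonpos hu.1 (by linarith))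
  · have hU₁ : U ^ (1 - β) ≤ 1 := Real.rpow_le_one_of_one_le_of_nonpos hU (by linarith)
    rw [sub_self, mul_zero, Real.exp_zero, one_mul]
    have : U ^ (1 - β) / (A * β) ≤ 1 := by
      rw [div_le_one (by positivity)]
      nlinarith
    linarith

theorem truncated_flatPhase_eq {A β b : ℝ}
    (hcont : ContinuousOn (flatPhase A β b) (Set.Icc (-Real.exp (b - 1)) (Real.exp (b - 1))))
    (B : ℝ) {ε : ℝ} (hε : 0 < ε) (hεr : ε ≤ Real.exp (b - 1)) :
    truncated (Real.exp (b - 1)) (flatPhase A β b) (Real.exp (A * B)) ε =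
      ∫ u in (1)..(b - Real.log ε), (expI (Real.exp (A * (B - u ^ β))) - 1) := by
  have hphase : ∀ u : ℝ, expI (Real.exp (A * B) * flatPhase A β b (Real.exp (b - u))) -
      expI (Real.exp (A * B) * flatPhase A β b (-Real.exp (b - u))) =
        expI (Real.exp (A * (B - u ^ β))) - 1 := fun u => by
    have hpos := Real.exp_pos (b - u)
    rw [flatPhase, flatPhase, if_neg hpos.not_ge, if_pos (neg_nonpos.2 hpos.le), Real.log_exp,
      sub_sub_cancel, mul_zero, ← Real.exp_add, mul_sub, sub_eq_add_neg (A * B)]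
    simp [expI]
  have hsubst := oscIntegral_exp_sub (fun t => Real.exp (A * B) * flatPhase A β b t) b 1
    (b - Real.log ε)
  simp only [hphase, sub_sub_cancel, Real.exp_log hε] at hsubst
  rw [truncated_eq_oscIntegral hcont _ hε hεr, hsubst]

theorem norm_truncated_flatPhase_sub_le {A β b U : ℝ} (hA : 1 ≤ A) (hβ : 1 ≤ β) (hU : 1 ≤ U)
    (hcont : ContinuousOn (flatPhase A β b) (Set.Icc (-Real.exp (b - 1)) (Real.exp (b - 1))))
    {ε : ℝ} (hε : 0 < ε) (hεU : ε ≤ Real.exp (b - U)) :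
    ‖truncated (Real.exp (b - 1)) (flatPhase A β b) (Real.exp (A * U ^ β)) ε - (1 - U : ℝ)‖ ≤
      3 := by
  have hE : U ≤ b - Real.log ε := by linarith [(Real.log_le_iff_le_exp hε).2 hεU]
  have hint : ∀ {v w : ℝ}, 1 ≤ v → v ≤ w →
      IntervalIntegrable (fun u => expI (Real.exp (A * (U ^ β - u ^ β)))) volume v w := by
    intro v w hv hvw
    refine ContinuousOn.intervalIntegrable_of_Icc hvw ?_
    have hrpow : ContinuousOn (fun u : ℝ => u ^ β) (Set.Icc v w) :=
      continuousOn_id.rpow_const fun u hu => Or.inl (zero_lt_one.trans_le (hv.trans hu.1)).ne'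
    fun_prop
  have hsplit : (∫ u in (1)..(b - Real.log ε), (expI (Real.exp (A * (U ^ β - u ^ β))) - 1)) -
      (1 - U : ℝ) = (∫ u in (1)..U, expI (Real.exp (A * (U ^ β - u ^ β)))) +
        ∫ u in U..(b - Real.log ε), (expI (Real.exp (A * (U ^ β - u ^ β))) - 1) := by
    rw [← intervalIntegral.integral_add_adjacent_intervals ((hint le_rfl hU).sub (by simp))
      ((hint hU hE).sub (by simp)), intervalIntegral.integral_sub (hint le_rfl hU) (by simp),
      intervalIntegral.integral_const, Complex.real_smul]
    push_cast
    ring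
  rw [truncated_flatPhase_eq hcont _ hε (hεU.trans (Real.exp_le_exp.2 (by linarith))), hsplit]
  refine (norm_add_le _ _).trans ?_
  linarith [norm_integral_expI_exp_le hA hβ hU, norm_integral_expI_exp_sub_one_le hA hβ hU hE]

theorem MemDenjoyCarleman.attainsGrowth_flatPhase {α β A b : ℝ} {M : ℕ → ℝ}
    (h : MemDenjoyCarleman M (Real.exp (b - 1)) (flatPhase A β b)) (hαβ : α.HolderConjugate β)
    (hA : 1 ≤ A) : AttainsGrowth α (Real.exp (b - 1)) (flatPhase A β b) := by
  have hβ := hαβ.symm.lt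
  have hA₀ : 0 < A := zero_lt_one.trans_le hA
  have hβ₀ : 0 < β := zero_lt_one.trans hβ
  set lam : ℕ → ℝ := fun n => Real.exp (A * (n : ℝ) ^ β) with hlam
  have hlog : ∀ n, Real.log (lam n) ^ (1 - 1 / α) = A ^ β⁻¹ * n := fun n => by
    rw [hlam, Real.log_exp, one_div, hαβ.one_sub_inv,
      Real.mul_rpow hA₀.le (by positivity), Real.rpow_rpow_inv n.cast_nonneg hβ₀.ne']
  have hequiv : (fun n => ‖m (Real.exp (b - 1)) (flatPhase A β b) (lam n)‖) ~[atTop]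
      fun n => (n : ℝ) := by
    refine IsBigO.trans_isLittleO (g := fun _ => (1 : ℝ)) (IsBigO.of_bound 4 ?_)
      (isLittleO_const_left.2 (Or.inr (tendsto_norm_atTop_atTop.comp tendsto_natCast_atTop_atTop)))
    filter_upwards [eventually_ge_atTop 1] with n hn
    have hn₁ : (1 : ℝ) ≤ n := Nat.one_le_cast.2 hn
    have hclose := (h.hasPV (Real.exp_pos _) (lam n)).norm_sub_le (Real.exp_pos (b - n))
      fun ε hε hεn => norm_truncated_flatPhase_sub_le hA hβ.le hn₁ h.1.continuousOn hε hεn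
    have habs := abs_le.1 ((abs_norm_sub_norm_le _ _).trans hclose)
    rw [Complex.norm_real, Real.norm_of_nonpos (by linarith : 1 - (n : ℝ) ≤ 0)] at habs
    rw [Pi.sub_apply, norm_one, mul_one, Real.norm_eq_abs, abs_le]
    constructor <;> linarith [habs.1, habs.2]
  refine ⟨lam, Real.tendsto_exp_atTop.comp (((tendsto_rpow_atTop hβ₀).comp
    tendsto_natCast_atTop_atTop).const_mul_atTop hA₀), hequiv.isTheta.trans ?_⟩
  simp only [hlog]
  exact (isTheta_refl _ _).const_mul_right (by positivity)

theorem sharpPhase_eq_flatPhase (α : ℝ) : sharpPhase α = flatPhase 1 (α / (α - 1)) 0 := by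
  ext t
  simp only [sharpPhase, flatPhase, one_div, Real.log_inv, one_mul, zero_sub]

theorem exists_flatPhase_mem_attainsGrowth {α c r : ℝ} (hα : 1 < α) (hc : 0 < c) (hr : 0 < r) :
    ∃ ψ : ℝ → ℝ, MemDenjoyCarleman (weight c α) r ψ ∧ AttainsGrowth α r ψ := by
  have hαβ := Real.HolderConjugate.conjExponent hα
  set β := α.conjExponent
  obtain ⟨b, rfl⟩ : ∃ b, r = Real.exp (b - 1) :=
    ⟨Real.log r + 1, by rw [add_sub_cancel_right, Real.exp_log hr]⟩
  have hlim : Tendsto (fun A => (β * (A / 2)) ^ (1 - α) / α) atTop (𝓝 0) := by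
    have hbase : Tendsto (fun A => β * (A / 2)) atTop atTop :=
      (tendsto_id.atTop_div_const two_pos).const_mul_atTop hαβ.symm.pos
    simpa using ((tendsto_rpow_neg_atTop (sub_pos.2 hα)).comp hbase).div_const α
  obtain ⟨A, hAc, hA⟩ := ((hlim.eventually_lt_const hc).and (eventually_ge_atTop 1)).exists
  have hmem := memDenjoyCarleman_flatPhase (b := b) hαβ (zero_lt_one.trans_le hA) hAc
  exact ⟨_, hmem, hmem.attainsGrowth_flatPhase hαβ hA⟩

theorem exists_sharpPhase_mem {α : ℝ} (hα : 1 < α) :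
    ∃ c : ℝ, 0 < c ∧ MemDenjoyCarleman (weight c α) (Real.exp (-1)) (sharpPhase α) := by
  have hαβ := Real.HolderConjugate.conjExponent hα
  have hβ := hαβ.symm.pos
  refine ⟨(α.conjExponent * (1 / 2)) ^ (1 - α) / α + 1, by positivity, ?_⟩
  rw [sharpPhase_eq_flatPhase, ← zero_sub]
  exact memDenjoyCarleman_flatPhase hαβ one_pos (lt_add_one _)

theorem MemDenjoyCarleman.attainsGrowth_sharpPhase {α : ℝ} {M : ℕ → ℝ}
    (h : MemDenjoyCarleman M (Real.exp (-1)) (sharpPhase α)) (hα : 1 < α) :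
    AttainsGrowth α (Real.exp (-1)) (sharpPhase α) := by
  rw [sharpPhase_eq_flatPhase, ← zero_sub] at h ⊢
  exact h.attainsGrowth_flatPhase (Real.HolderConjugate.conjExponent hα) le_rfl

end SteinWainger

end

theorem theorem7p1_general (α : ℝ) (hα : 1 < α) (r : ℝ) (hr : 0 < r) :
    (∀ c : ℝ, 0 < c →
      (∀ ψ : ℝ → ℝ, SteinWainger.MemDenjoyCarleman (SteinWainger.weight c α) r ψ →
        (∀ lam : ℝ, SteinWainger.HasPV r ψ lam (SteinWainger.m r ψ lam)) ∧
        (fun lam : ℝ => SteinWainger.m r ψ lam) =O[atTop]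
          (fun lam : ℝ => (Real.log lam) ^ (1 - 1 / α))) ∧
      (∃ ψ : ℝ → ℝ, SteinWainger.MemDenjoyCarleman (SteinWainger.weight c α) r ψ ∧
        SteinWainger.AttainsGrowth α r ψ)) ∧
    (∃ c : ℝ, 0 < c ∧ SteinWainger.MemDenjoyCarleman (SteinWainger.weight c α)
      (Real.exp (-1)) (SteinWainger.sharpPhase α)) ∧
    (∀ lam : ℝ, SteinWainger.HasPV (Real.exp (-1)) (SteinWainger.sharpPhase α) lam
      (SteinWainger.m (Real.exp (-1)) (SteinWainger.sharpPhase α) lam)) ∧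
    SteinWainger.AttainsGrowth α (Real.exp (-1)) (SteinWainger.sharpPhase α) := by
  obtain ⟨c, hc, hmem⟩ := SteinWainger.exists_sharpPhase_mem hα
  exact ⟨fun c hc => ⟨fun ψ hψ => ⟨hψ.hasPV hr, hψ.isBigO_m hα hc.le hr⟩,
    SteinWainger.exists_flatPhase_mem_attainsGrowth hα hc hr⟩,
    ⟨c, hc, hmem⟩, hmem.hasPV (Real.exp_pos _), hmem.attainsGrowth_sharpPhase hα⟩

theorem theorem7p1 (α : ℝ) (hα : 1 < α) :
    (∀ c : ℝ, 0 < c →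
      (∀ ψ : ℝ → ℝ, SteinWainger.MemDenjoyCarleman (SteinWainger.weight c α) 1 ψ →
        (∀ lam : ℝ, SteinWainger.HasPV 1 ψ lam (SteinWainger.m 1 ψ lam)) ∧
        (fun lam : ℝ => SteinWainger.m 1 ψ lam) =O[atTop]
          (fun lam : ℝ => (Real.log lam) ^ (1 - 1 / α))) ∧
      (∃ ψ : ℝ → ℝ, SteinWainger.MemDenjoyCarleman (SteinWainger.weight c α) 1 ψ ∧
        SteinWainger.AttainsGrowth α 1 ψ)) ∧
    (∃ c : ℝ, 0 < c ∧ SteinWainger.MemDenjoyCarleman (SteinWainger.weight c α)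
      (Real.exp (-1)) (SteinWainger.sharpPhase α)) ∧
    (∀ lam : ℝ, SteinWainger.HasPV (Real.exp (-1)) (SteinWainger.sharpPhase α) lam
      (SteinWainger.m (Real.exp (-1)) (SteinWainger.sharpPhase α) lam)) ∧
    SteinWainger.AttainsGrowth α (Real.exp (-1)) (SteinWainger.sharpPhase α) :=
  theorem7p1_general α hα 1 one_pos
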